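/- Let $r$ and $m$ be integers with $1\le r\le 23$, $(r,6)=1$, and $m\ge 0$ even. Let $M_m(1)$ be the space of modular forms of weight $m$ for $\mathrm{SL}_2(\mathbb Z)$, let $\eta(\tau)=q^{1/24}\prod_{n\ge1}(1-q^n)$, $q=e^{2\pi i\tau}$, be the Dedekind eta function, and let $\chi_{12}$ be the Dirichlet character with $\chi_{12}(n)=1$ if $n\equiv\pm1\pmod{12}$, $\chi_{12}(n)=-1$ if $n\equiv\pm5\pmod{12}$, and $\chi_{12}(n)=0$ otherwise. Put $k=m+\tfrac{r-1}{2}$, so that $k+\tfrac12=\tfrac r2+m$, and let $S_{k+\frac12}(576,\chi_{12})$ be the space of cusp forms of weight $k+\tfrac12$ and character $\chi_{12}$ for $\Gamma_0(576)$ in the sense of Shimura, that is, of the holomorphic functions $f$ on the upper half plane that satisfy $$f\left(\frac{a\tau+b}{c\tau+d}\right)=\chi_{12}(d)\left(\frac{\theta\left(\frac{a\tau+b}{c\tau+d}\right)}{\theta(\tau)}\right)^{2k+1}f(\tau),\qquad \theta(\tau)=\sum_{n\in\mathbb Z}q^{n^2},$$ for all $\begin{pmatrix}a&b\\c&d\end{pmatrix}\in\Gamma_0(576)$,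 and vanish at all cusps. For a prime $\ell>3$ and $f=\sum_{n\ge0}a(n)q^n$ in this space, put $f\mid T(\ell^2)=\sum_{n\ge0}c(n)q^n$, where $$c(n)=a(\ell^2n)+\chi_{12}(\ell)\left(\frac{(-1)^kn}{\ell}\right)\ell^{k-1}a(n)+\chi_{12}(\ell^2)\,\ell^{2k-1}a(n/\ell^2),$$ $\left(\frac{\cdot}{\ell}\right)$ is the Legendre symbol, and $a(x)=0$ if $x$ is not a nonnegative integer. If $\dim M_m(1)=1$ and $0\ne F\in M_m(1)$, then $g(\tau)=\eta^r(24\tau)F(24\tau)$ is a Hecke eigenform in $S_{\frac r2+m}(576,\chi_{12})$: the function $g$ is a nonzero element of this space, and for every prime $\ell>3$ there is a $\lambda_\ell\in\mathbb C$ such that $g\mid T(\ell^2)=\lambda_\ell\, g$. -/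

import Mathlib

open UpperHalfPlane ModularForm
open scoped MatrixGroups Manifold

noncomputable section

namespace HalfIntegral

/-- The point `d τ` of the upper half plane, for a positive integer `d`. -/
def dilate (d : ℕ) [NeZero d] (τ : ℍ) : ℍ :=
  ⟨(d : ℂ) * (τ : ℂ), by
    have hd : (0 : ℝ) < d := Nat.cast_pos.mpr (Nat.pos_of_ne_zero (NeZero.ne d))
    simpa using mul_pos hd τ.im_pos⟩

/-- The integer-valued character `χ₁₂` modulo `12`. -/
def chiTwelveInt : MulChar (ZMod 12) ℤ where
  toFun a := if a = 1 ∨ a = -1 then 1 else if a = 5 ∨ a = -5 then -1 else 0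
  map_one' := by decide
  map_mul' := by decide
  map_nonunit' := by decide

/-- `χ₁₂` as a complex Dirichlet character modulo `12`. -/
def chiTwelve : DirichletCharacter ℂ 12 :=
  chiTwelveInt.ringHomComp (Int.castRingHom ℂ)

/-- `χ₁₂` as a Dirichlet character modulo `576`. -/
def chiTwelve576 : DirichletCharacter ℂ 576 :=
  DirichletCharacter.changeLevel (by norm_num : 12 ∣ 576) chiTwelve

/-- Shimura's theta function `θ(τ) = ∑_{n ∈ ℤ} exp(2πi n² τ)`; Mathlib's `jacobiTheta` is
`∑_{n ∈ ℤ} exp(πi n² τ)`. -/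
def theta (τ : ℍ) : ℂ := jacobiTheta (2 * (τ : ℂ))

/-- Shimura's automorphy factor `j(γ, τ) = θ(γτ) / θ(τ)`, of weight `1/2`, for `γ ∈ Γ₀(4)`
(`θ` has no zeros in the upper half plane). -/
def thetaFactor (γ : SL(2, ℤ)) (τ : ℍ) : ℂ := theta (γ • τ) / theta τ

/-- `(α, φ)` is an element of Shimura's group `G` lying over `α ∈ SL₂(ℤ)`: the function `φ` is
holomorphic and `φ(τ)² = s (cτ + d)` with a constant `s` of absolute value `1`, where `(c d)` is
the last row of `α`. -/
def IsShimuraPair (α : SL(2, ℤ)) (φ : ℍ → ℂ) : Prop :=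
  MDifferentiable 𝓘(ℂ) 𝓘(ℂ) φ ∧
    ∃ s : ℂ, ‖s‖ = 1 ∧ ∀ τ : ℍ, φ τ ^ 2 = s * ((α 1 0 : ℂ) * (τ : ℂ) + (α 1 1 : ℂ))

/-- The slash operator of weight `k + 1/2`: `(f | (α, φ))(τ) = φ(τ)^(-2k-1) f(ατ)`. -/
def halfSlash (k : ℕ) (f : ℍ → ℂ) (α : SL(2, ℤ)) (φ : ℍ → ℂ) (τ : ℍ) : ℂ :=
  (φ τ ^ (2 * k + 1))⁻¹ * f (α • τ)

/-- `f ∈ S_{k+1/2}(N, χ)`, for `4 ∣ N`, in the sense of Shimura: `f` is holomorphic on the upper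
half plane, `f(γτ) = χ(d) j(γ, τ)^(2k+1) f(τ)` for all `γ ∈ Γ₀(N)` with lower right entry `d`,
and `f` vanishes at every cusp `α(∞)`, `α ∈ SL₂(ℤ)`. -/
structure IsCuspForm (k N : ℕ) (χ : DirichletCharacter ℂ N) (f : ℍ → ℂ) : Prop where
  holo : MDifferentiable 𝓘(ℂ) 𝓘(ℂ) f
  transform : ∀ γ ∈ CongruenceSubgroup.Gamma0 N, ∀ τ : ℍ,
    f (γ • τ) = χ ((γ 1 1 : ℤ) : ZMod N) * thetaFactor γ τ ^ (2 * k + 1) * f τ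
  zero_at_cusps : ∀ (α : SL(2, ℤ)) (φ : ℍ → ℂ), IsShimuraPair α φ →
    IsZeroAtImInfty (halfSlash k f α φ)

/-- The action of the Hecke operator `T(ℓ²)` of weight `k + 1/2` and character `χ` on Fourier
coefficients:
`c(n) = a(ℓ² n) + χ(ℓ) ((-1)^k n / ℓ) ℓ^(k-1) a(n) + χ(ℓ²) ℓ^(2k-1) a(n / ℓ²)`,
where `a(n / ℓ²) = 0` unless `ℓ² ∣ n`. -/
def heckeCoeff (k : ℕ) {N : ℕ} (χ : DirichletCharacter ℂ N) (ℓ : ℕ) [Fact ℓ.Prime]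
    (a : ℕ → ℂ) (n : ℕ) : ℂ :=
  a (ℓ ^ 2 * n)
    + χ (ℓ : ZMod N) * (legendreSym ℓ ((-1) ^ k * (n : ℤ)) : ℂ) * (ℓ : ℂ) ^ ((k : ℤ) - 1) * a n
    + χ ((ℓ ^ 2 : ℕ) : ZMod N) * (ℓ : ℂ) ^ (2 * (k : ℤ) - 1) *
        (if ℓ ^ 2 ∣ n then a (n / ℓ ^ 2) else 0)

/-- The `n`-th term `c(n) q^n`, `q = exp(2πiτ)`, of the Fourier series of `f | T(ℓ²)`. -/
def heckeTerm (k : ℕ) {N : ℕ} (χ : DirichletCharacter ℂ N) (ℓ : ℕ) [Fact ℓ.Prime]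
    (f : ℍ → ℂ) (τ : ℍ) (n : ℕ) : ℂ :=
  heckeCoeff k χ ℓ (fun j => (qExpansion 1 f).coeff j) n * Function.Periodic.qParam 1 (τ : ℂ) ^ n

/-- The Hecke operator `f ↦ f | T(ℓ²)` of weight `k + 1/2` and character `χ`. -/
def heckeT (k : ℕ) {N : ℕ} (χ : DirichletCharacter ℂ N) (ℓ : ℕ) [Fact ℓ.Prime]
    (f : ℍ → ℂ) (τ : ℍ) : ℂ :=
  ∑' n : ℕ, heckeTerm k χ ℓ f τ n

/-- The function `τ ↦ η(24τ)^r F(24τ)`. -/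
def etaTwist (r : ℕ) (F : ℍ → ℂ) (τ : ℍ) : ℂ :=
  eta (24 * (τ : ℂ)) ^ r * F (dilate 24 τ)

end HalfIntegral

end

/-!
Both `η` and `θ` are theta series with periodic coefficients. Poisson summation therefore describes
them near a rational point `b / d` by quadratic Gauss sums, and the sums belonging to `η(24τ)` and
to `θ(τ)` agree up to the factor `χ₁₂(d)`. Hence `η(24γτ) / η(24τ) = χ₁₂(d) θ(γτ) / θ(τ)` for
`γ ∈ Γ₀(576)`, and vanishing at the cusps is inherited from `η²⁴ = Δ`.

For the Hecke operator, write `g(τ) = f(24τ)` with `f = η^r F`. On `f`, `T(ℓ²)` is a sum over the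
translates `(z + 24 b) / D`, `D ∣ ℓ²`, and the behaviour of `η` near rational points shows that the
sum transforms under `z ↦ -1 / z` like `f` itself. Its Fourier expansion is supported on the same
residue class modulo `24`, since `ℓ² ≡ 1`, so its quotient by `η^r` is a modular form of weight `m`
and level one, a multiple of `F` if these forms make up a line.
-/

open Function.Periodic (qParam)
open scoped Real

noncomputable section

namespace HalfIntegral

section PeriodicTheta

/-- The theta series `∑_{n ∈ ℤ} f(n) exp(2πi n² w)` attached to a function `f` of period `N`; both
`θ` and `η` are of this form. -/
def thetaSeries {N : ℕ} (f : ZMod N → ℂ) (w : ℂ) : ℂ :=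
  ∑' n : ℤ, f n * Complex.exp (2 * π * Complex.I * (n : ℂ) ^ 2 * w)

lemma neg_ofReal_div_im_pos {c : ℝ} (hc : 0 < c) {z : ℂ} (hz : 0 < z.im) :
    0 < (-(c : ℂ) / z).im := by
  have hz0 : z ≠ 0 := fun h ↦ by simp [h] at hz
  have : (-(c : ℂ) / z).im = c * (z.im / Complex.normSq z) := by
    simp only [Complex.div_im, Complex.neg_im, Complex.neg_re, Complex.ofReal_im, Complex.ofReal_re]
    ring
  rw [this]
  exact mul_pos hc (div_pos hz (Complex.normSq_pos.mpr hz0))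

lemma summable_norm_cexp_sq {w : ℂ} (hw : 0 < w.im) :
    Summable fun n : ℤ ↦ ‖Complex.exp (2 * π * Complex.I * (n : ℂ) ^ 2 * w)‖ := by
  have h2w : 0 < (2 * w).im := by simpa using hw
  refine ((summable_jacobiTheta₂_term_iff 0 (2 * w)).mpr h2w).norm.congr fun n ↦ ?_
  rw [jacobiTheta₂_term]
  ring_nf

lemma summable_mul_cexp_sq {w : ℂ} (hw : 0 < w.im) {N : ℕ} [NeZero N] (f : ZMod N → ℂ) :
    Summable fun n : ℤ ↦ f n * Complex.exp (2 * π * Complex.I * (n : ℂ) ^ 2 * w) := by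
  refine .of_norm_bounded ((summable_norm_cexp_sq hw).mul_left (∑ x, ‖f x‖)) fun n ↦ ?_
  rw [norm_mul]
  gcongr
  exact Finset.single_le_sum (f := fun x ↦ ‖f x‖) (fun _ _ ↦ norm_nonneg _) (Finset.mem_univ _)

lemma thetaSeries_const_mul {N : ℕ} (c : ℂ) (f : ZMod N → ℂ) (w : ℂ) :
    thetaSeries (fun x ↦ c * f x) w = c * thetaSeries f w := by
  simp only [thetaSeries, mul_assoc, tsum_mul_left]

lemma tsum_int_eq_sum_zmod (N : ℕ) [NeZero N] {F : ℤ → ℂ} (hF : Summable F) :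
    ∑' n, F n = ∑ j : ZMod N, ∑' m : ℤ, F (m * N + j.val) := by
  obtain _ | N := N
  · exact (NeZero.ne 0 rfl).elim
  let e := (Equiv.prodComm (Fin (N + 1)) ℤ).trans (Int.divModEquiv (N + 1)).symm
  rw [← e.tsum_eq]
  refine (Summable.tsum_prod (e.summable_iff.mpr hF)).trans ?_
  rw [tsum_fintype]
  rfl

lemma eq_inv_mul_sum_stdAddChar_mul_dft {N : ℕ} [NeZero N] (f : ZMod N → ℂ) (x : ZMod N) :
    f x = (N : ℂ)⁻¹ * ∑ j, ZMod.stdAddChar (j * x) * ZMod.dft f j := by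
  simpa only [ZMod.invDFT_apply, smul_eq_mul] using
    (congrFun (ZMod.dft.symm_apply_apply f) x).symm

lemma stdAddChar_mul_intCast {N : ℕ} [NeZero N] (j : ZMod N) (n : ℤ) :
    ZMod.stdAddChar (j * (n : ZMod N)) = Complex.exp (2 * π * Complex.I * n * (j.val / N)) := by
  have := ZMod.stdAddChar_coe (N := N) (j.val * n)
  push_cast [ZMod.natCast_zmod_val] at this
  rw [this]
  ring_nf

lemma thetaSeries_eq_sum_dft_mul_jacobiTheta₂ {N : ℕ} [NeZero N] (f : ZMod N → ℂ) {w : ℂ}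
    (hw : 0 < w.im) :
    thetaSeries f w =
      (N : ℂ)⁻¹ * ∑ j : ZMod N, ZMod.dft f j * jacobiTheta₂ (j.val / N) (2 * w) := by
  have h2w : 0 < (2 * w).im := by simpa using hw
  have hterm (n : ℤ) : f n * Complex.exp (2 * π * Complex.I * (n : ℂ) ^ 2 * w) =
      (N : ℂ)⁻¹ * ∑ j : ZMod N, ZMod.dft f j * jacobiTheta₂_term n (j.val / N) (2 * w) := by
    rw [eq_inv_mul_sum_stdAddChar_mul_dft f n, mul_assoc, Finset.sum_mul]
    congr! 2 with j
    rw [stdAddChar_mul_intCast, jacobiTheta₂_term, Complex.exp_add]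
    ring_nf
  rw [thetaSeries, tsum_congr hterm, tsum_mul_left, Summable.tsum_finsetSum fun j _ ↦
    ((summable_jacobiTheta₂_term_iff _ _).mpr h2w).mul_left _]
  simp only [jacobiTheta₂, tsum_mul_left]

lemma thetaSeries_eq_sum_mul_jacobiTheta₂ {N : ℕ} [NeZero N] (f : ZMod N → ℂ) {w : ℂ}
    (hw : 0 < w.im) :
    thetaSeries f w = ∑ j : ZMod N, f j * (Complex.exp (2 * π * Complex.I * (j.val : ℂ) ^ 2 * w) *
      jacobiTheta₂ (2 * j.val * N * w) (2 * N ^ 2 * w)) := by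
  rw [thetaSeries, tsum_int_eq_sum_zmod N (summable_mul_cexp_sq hw f)]
  refine Finset.sum_congr rfl fun j _ ↦ ?_
  rw [jacobiTheta₂, ← tsum_mul_left, ← tsum_mul_left]
  refine tsum_congr fun m ↦ ?_
  push_cast
  rw [ZMod.natCast_self, mul_zero, zero_add, ZMod.natCast_zmod_val, jacobiTheta₂_term,
    ← Complex.exp_add]
  ring_nf

theorem thetaSeries_functional_equation {N : ℕ} [NeZero N] (f : ZMod N → ℂ) {w : ℂ}
    (hw : 0 < w.im) :
    thetaSeries f w = 1 / (-Complex.I * (2 * w)) ^ (1 / 2 : ℂ) * ((N : ℂ)⁻¹ *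
      thetaSeries (ZMod.dft f) (-1 / (4 * (N : ℂ) ^ 2 * w))) := by
  have hN : (N : ℂ) ≠ 0 := NeZero.ne _
  have hw0 : w ≠ 0 := fun h ↦ by simp [h] at hw
  have hw' : 0 < (-1 / (4 * (N : ℂ) ^ 2 * w)).im := by
    have hc : (0 : ℝ) < 1 / (4 * N ^ 2) := by have := NeZero.pos N; positivity
    convert neg_ofReal_div_im_pos hc hw using 2
    push_cast
    field_simp
  rw [thetaSeries_eq_sum_dft_mul_jacobiTheta₂ f hw, thetaSeries_eq_sum_mul_jacobiTheta₂ _ hw',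
    mul_left_comm]
  congr 1
  rw [Finset.mul_sum]
  refine Finset.sum_congr rfl fun j _ ↦ ?_
  rw [jacobiTheta₂_functional_equation, ← jacobiTheta₂_neg_left (_ / (2 * w))]
  have h1 : -π * Complex.I * (j.val / N : ℂ) ^ 2 / (2 * w) =
      2 * π * Complex.I * j.val ^ 2 * (-1 / (4 * N ^ 2 * w)) := by field_simp; ring
  have h2 : -(j.val / N / (2 * w)) = 2 * j.val * N * (-1 / (4 * N ^ 2 * w)) := by field_simp; ring
  have h3 : -1 / (2 * w) = 2 * N ^ 2 * (-1 / (4 * N ^ 2 * w)) := by field_simp; ring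
  rw [h1, h2, h3]
  ring

end PeriodicTheta

section RationalPoint

/-- The quadratic Gauss sum `∑ exp(2πi b x² / d)` over `x` modulo `d`. -/
def quadGauss {d : ℕ} [NeZero d] (b : ZMod d) : ℂ :=
  ∑ x : ZMod d, ZMod.stdAddChar (b * x ^ 2)

/-- The product of `f(n)`, of period `N`, and `exp(2πi b n² / d)`, of period `d`, as a function of
period `N d`; its theta series is that of `f` translated by `b / d`. -/
def quadTwist {N d : ℕ} [NeZero d] (f : ZMod N → ℂ) (b : ZMod d) (x : ZMod (N * d)) : ℂ :=
  f (ZMod.castHom (Dvd.intro _ rfl) (ZMod N) x) *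
    ZMod.stdAddChar (b * ZMod.castHom (Dvd.intro_left _ rfl) (ZMod d) x ^ 2)

lemma stdAddChar_mul_add_mul {N d : ℕ} [NeZero N] [NeZero d] (v u t : ℤ) :
    ZMod.stdAddChar (N := N * d) (-((d * v + N * u : ℤ) * t : ZMod (N * d))) =
      ZMod.stdAddChar (N := N) (-(v * t)) * ZMod.stdAddChar (N := d) (-(u * t)) := by
  have hNd := ZMod.stdAddChar_coe (N := N * d) (-((d * v + N * u) * t))
  have hN := ZMod.stdAddChar_coe (N := N) (-(v * t))
  have hd := ZMod.stdAddChar_coe (N := d) (-(u * t))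
  push_cast at hNd hN hd ⊢
  have hN0 : (N : ℂ) ≠ 0 := NeZero.ne _
  have hd0 : (d : ℂ) ≠ 0 := NeZero.ne _
  rw [hNd, hN, hd, ← Complex.exp_add]
  congr 1
  field_simp
  ring

lemma bijective_mul_add_mul {N d : ℕ} [NeZero N] [NeZero d] (h : N.Coprime d) :
    Function.Bijective fun p : ZMod N × ZMod d ↦
      ((d * (p.1.val : ℤ) + N * (p.2.val : ℤ) : ℤ) : ZMod (N * d)) := by
  rw [Fintype.bijective_iff_injective_and_card]
  refine ⟨fun p p' hp ↦ ?_, by simp [ZMod.card]⟩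
  have hN := congrArg (ZMod.castHom (Dvd.intro _ rfl : N ∣ N * d) (ZMod N)) hp
  have hd := congrArg (ZMod.castHom (Dvd.intro_left _ rfl : d ∣ N * d) (ZMod d)) hp
  simp only [map_intCast] at hN hd
  push_cast at hN hd
  simp only [ZMod.natCast_self, ZMod.natCast_zmod_val, zero_mul, add_zero, zero_add] at hN hd
  exact Prod.ext (((ZMod.isUnit_iff_coprime d N).mpr h.symm).mul_left_cancel hN)
    (((ZMod.isUnit_iff_coprime N d).mpr h).mul_left_cancel hd)

lemma sum_stdAddChar_quadratic {N d : ℕ} [NeZero d] (h : N.Coprime d) {b b' : ZMod d}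
    (hb : 4 * N ^ 2 * b * b' = -1) (t : ZMod d) :
    ∑ u : ZMod d, ZMod.stdAddChar (-(u * t)) * ZMod.stdAddChar (b * ((N : ZMod d) * u) ^ 2) =
      quadGauss b * ZMod.stdAddChar (b' * t ^ 2) := by
  have hN : IsUnit (N : ZMod d) := (ZMod.isUnit_iff_coprime N d).mpr h
  have complete_square (u : ZMod d) :
      ZMod.stdAddChar (-(u * t)) * ZMod.stdAddChar (b * ((N : ZMod d) * u) ^ 2) =
        ZMod.stdAddChar (b * ((N : ZMod d) * (u + 2 * b' * t)) ^ 2) *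
          ZMod.stdAddChar (b' * t ^ 2) := by
    rw [← AddChar.map_add_eq_mul, ← AddChar.map_add_eq_mul]
    congr 1
    linear_combination (-(u * t) - b' * t ^ 2) * hb
  simp_rw [complete_square]
  rw [← Finset.sum_mul, quadGauss]
  congr 1
  exact ((Equiv.addRight (2 * b' * t)).trans hN.unit.mulLeft).sum_comp
    fun x ↦ ZMod.stdAddChar (b * x ^ 2)

lemma dft_quadTwist {N d : ℕ} [NeZero N] [NeZero d] (h : N.Coprime d) (f : ZMod N → ℂ)
    {b b' : ZMod d} (hb : 4 * N ^ 2 * b * b' = -1) (t : ℤ) :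
    ZMod.dft (quadTwist f b) t = ZMod.dft (fun x ↦ f ((d : ZMod N) * x)) t *
      (quadGauss b * ZMod.stdAddChar (b' * (t : ZMod d) ^ 2)) := by
  rw [← sum_stdAddChar_quadratic h hb, ZMod.dft_apply, ZMod.dft_apply, Finset.sum_mul_sum,
    ← Finset.sum_product', ← (Equiv.ofBijective _ (bijective_mul_add_mul h)).sum_comp]
  refine Finset.sum_congr Finset.univ_product_univ.symm fun p _ ↦ ?_
  rw [Equiv.ofBijective_apply, stdAddChar_mul_add_mul, quadTwist]
  simp only [map_intCast, smul_eq_mul]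
  push_cast
  simp only [ZMod.natCast_self, ZMod.natCast_zmod_val, zero_mul, add_zero, zero_add]
  ring

lemma stdAddChar_intCast_mul_sq {d : ℕ} [NeZero d] (b n : ℤ) :
    ZMod.stdAddChar ((b : ZMod d) * (n : ZMod d) ^ 2) =
      Complex.exp (2 * π * Complex.I * (n : ℂ) ^ 2 * (b / d)) := by
  have := ZMod.stdAddChar_coe (N := d) (b * n ^ 2)
  push_cast at this
  rw [this]
  ring_nf

lemma thetaSeries_quadTwist {N d : ℕ} [NeZero d] (f : ZMod N → ℂ) (b : ℤ) (w : ℂ) :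
    thetaSeries (quadTwist f (b : ZMod d)) w = thetaSeries f (b / d + w) := by
  refine tsum_congr fun n ↦ ?_
  simp only [quadTwist, map_intCast]
  rw [stdAddChar_intCast_mul_sq, mul_assoc, ← Complex.exp_add, ← mul_add]

lemma thetaSeries_dft_quadTwist {N d : ℕ} [NeZero N] [NeZero d] (h : N.Coprime d)
    (f : ZMod N → ℂ) {b b' : ℤ} (hb : (4 * N ^ 2 * b * b' : ZMod d) = -1) (w : ℂ) :
    thetaSeries (ZMod.dft (quadTwist f (b : ZMod d))) w =
      quadGauss (b : ZMod d) *
        thetaSeries (ZMod.dft fun x ↦ f ((d : ZMod N) * x)) (b' / d + w) := by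
  rw [thetaSeries, thetaSeries, ← tsum_mul_left]
  refine tsum_congr fun n ↦ ?_
  rw [dft_quadTwist h f hb, stdAddChar_intCast_mul_sq, mul_add _ _ w, Complex.exp_add]
  ring

lemma ofReal_mul_cpow_half {c : ℝ} (hc : 0 < c) (z : ℂ) :
    ((c : ℂ) * z) ^ (1 / 2 : ℂ) = √c * z ^ (1 / 2 : ℂ) := by
  rcases eq_or_ne z 0 with rfl | hz
  · simp
  have hc' : (c : ℂ) ≠ 0 := Complex.ofReal_ne_zero.mpr hc.ne'
  rw [Complex.cpow_def_of_ne_zero (mul_ne_zero hc' hz), Complex.log_ofReal_mul hc hz, add_mul,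
    Complex.exp_add, ← Complex.cpow_def_of_ne_zero hz, Complex.ofReal_log hc.le,
    ← Complex.cpow_def_of_ne_zero hc', Real.sqrt_eq_rpow, Complex.ofReal_cpow hc.le]
  push_cast
  rfl

lemma arg_neg_I_mul_ne_pi {σ : ℂ} (hσ : 0 < σ.im) : (-Complex.I * σ).arg ≠ π := fun h ↦ by
  have hre : σ.im < 0 := by simpa using (Complex.arg_eq_pi_iff.mp h).1
  exact hre.not_gt hσ

lemma one_div_ofReal_mul_inv_cpow_half {σ : ℂ} (hσ : 0 < σ.im) {c : ℝ} (hc : 0 < c) :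
    1 / ((c : ℂ) * (-Complex.I * σ)⁻¹) ^ (1 / 2 : ℂ) =
      (√c : ℂ)⁻¹ * (-Complex.I * σ) ^ (1 / 2 : ℂ) := by
  rw [ofReal_mul_cpow_half hc, Complex.inv_cpow _ _ (arg_neg_I_mul_ne_pi hσ), one_div, mul_inv,
    inv_inv]

lemma sqrt_div_mul_self (a : ℝ) {x : ℝ} (hx : 0 < x) : √(a / x) * x = √a * √x := by
  rw [Real.sqrt_div' a hx.le, div_mul_eq_mul_div, mul_div_assoc, Real.div_sqrt]

theorem thetaSeries_inversion {N d : ℕ} [NeZero N] [NeZero d] (h : N.Coprime d)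
    (f : ZMod N → ℂ) {b b' : ℤ} (hb : (d : ℤ) ∣ 4 * N ^ 2 * b * b' + 1) {σ : ℂ}
    (hσ : 0 < σ.im) :
    thetaSeries f ((b - 1 / σ) / d) = (√2 * N : ℂ)⁻¹ * (quadGauss (b : ZMod d) / √d) *
      (-Complex.I * σ) ^ (1 / 2 : ℂ) *
        thetaSeries (ZMod.dft fun x ↦ f ((d : ZMod N) * x)) ((σ / (4 * N ^ 2) + b') / d) := by
  have hd : (d : ℂ) ≠ 0 := NeZero.ne _
  have hd' : (0 : ℝ) < d := Nat.cast_pos.mpr (NeZero.pos d)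
  have hN : (N : ℂ) ≠ 0 := NeZero.ne _
  have hb' : (4 * N ^ 2 * b * b' : ZMod d) = -1 := by
    rw [← ZMod.intCast_zmod_eq_zero_iff_dvd] at hb
    push_cast at hb
    exact eq_neg_of_add_eq_zero_left hb
  have hσ0 : σ ≠ 0 := fun h ↦ by simp [h] at hσ
  have hw : 0 < (-1 / (d * σ)).im := by
    convert neg_ofReal_div_im_pos (one_div_pos.mpr hd') hσ using 2
    push_cast
    field_simp
  have h1 : (b - 1 / σ) / d = b / d + -1 / (d * σ) := by field_simp; ring
  have h2 : -1 / (4 * ((N * d : ℕ) : ℂ) ^ 2 * (-1 / (d * σ))) = σ / (4 * N ^ 2) / d := by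
    push_cast; field_simp
  have h3 : -Complex.I * (2 * (-1 / (d * σ))) = ((2 / d : ℝ) : ℂ) * (-Complex.I * σ)⁻¹ := by
    push_cast
    field_simp
    rw [Complex.I_sq]
  rw [h1, ← thetaSeries_quadTwist, thetaSeries_functional_equation _ hw,
    thetaSeries_dft_quadTwist h f hb', h2, h3,
    one_div_ofReal_mul_inv_cpow_half hσ (by positivity), add_comm, ← add_div]
  have hc : (√(2 / d) * d : ℂ) = √2 * √d := mod_cast sqrt_div_mul_self 2 hd'
  have hc' : ((√(2 / d) : ℝ) : ℂ)⁻¹ * (d : ℂ)⁻¹ = (√2 : ℂ)⁻¹ * (√d : ℂ)⁻¹ := by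
    rw [← mul_inv, ← mul_inv, hc]
  push_cast
  linear_combination (quadGauss (b : ZMod d) * (N : ℂ)⁻¹ * (-Complex.I * σ) ^ (1 / 2 : ℂ) *
    thetaSeries (ZMod.dft fun x ↦ f ((d : ZMod N) * x)) ((σ / (4 * N ^ 2) + b') / d)) * hc'

end RationalPoint

section Pentagonal

variable {𝕜 : Type*} [NormedField 𝕜]

lemma norm_prod_one_sub_pow_le {x : 𝕜} (hx : ‖x‖ < 1) (k n : ℕ) :
    ‖∏ i ∈ Finset.range n, (1 - x ^ (k + i + 1))‖ ≤ Real.exp (1 - ‖x‖)⁻¹ := by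
  rw [norm_prod]
  calc ∏ i ∈ Finset.range n, ‖1 - x ^ (k + i + 1)‖
      ≤ ∏ i ∈ Finset.range n, Real.exp (‖x‖ ^ i) := by
        refine Finset.prod_le_prod (fun _ _ ↦ norm_nonneg _) fun i _ ↦ ?_
        calc ‖1 - x ^ (k + i + 1)‖ ≤ ‖x‖ ^ (k + i + 1) + 1 := by
              simpa [add_comm] using norm_sub_le 1 (x ^ (k + i + 1))
          _ ≤ ‖x‖ ^ i + 1 := by
              gcongr ?_ + 1
              exact pow_le_pow_of_le_one (norm_nonneg _) hx.le (by lia)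
          _ ≤ Real.exp (‖x‖ ^ i) := Real.add_one_le_exp _
    _ = Real.exp (∑ i ∈ Finset.range n, ‖x‖ ^ i) := (Real.exp_sum _ _).symm
    _ ≤ Real.exp (1 - ‖x‖)⁻¹ := by
        gcongr
        rw [← tsum_geometric_of_lt_one (norm_nonneg _) hx]
        exact (summable_geometric_of_lt_one (norm_nonneg _) hx).sum_le_tsum _
          fun _ _ ↦ by positivity

lemma norm_pow_mul_prod_one_sub_pow_le {x : 𝕜} (hx : ‖x‖ < 1) (k n : ℕ) :
    ‖x ^ ((k + 1) * n) * ∏ i ∈ Finset.range (n + 1), (1 - x ^ (k + i + 1))‖ ≤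
      Real.exp (1 - ‖x‖)⁻¹ * ‖x‖ ^ n := by
  rw [norm_mul, norm_pow, mul_comm]
  exact mul_le_mul (norm_prod_one_sub_pow_le hx k (n + 1))
    (pow_le_pow_of_le_one (norm_nonneg _) hx.le (Nat.le_mul_of_pos_left n k.succ_pos))
    (by positivity) (by positivity)

lemma le_pentagonal_neg (k : ℕ) : k ≤ pentagonal (-(k : ℤ)) := by
  have := two_mul_natCast_pentagonal_neg (k : ℤ)
  zify
  nlinarith [Int.le_self_sq (k : ℤ)]

lemma le_pentagonal_add_one (k : ℕ) : k ≤ pentagonal ((k : ℤ) + 1) := by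
  have := two_mul_natCast_pentagonal ((k : ℤ) + 1)
  zify
  nlinarith [Int.le_self_sq (k : ℤ)]

lemma tendsto_pentagonal_remainder {x : 𝕜} (hx : ‖x‖ < 1) :
    Filter.Tendsto (fun k ↦ (-1) ^ (k + 1) * x ^ ((k + 1) * (3 * k + 4) / 2) *
      ∑' n, x ^ ((k + 1) * n) * ∏ i ∈ Finset.range (n + 1), (1 - x ^ (k + i + 1)))
      Filter.atTop (nhds 0) := by
  have hlim := (tendsto_pow_atTop_nhds_zero_of_lt_one (norm_nonneg _) hx).mul_const
    (Real.exp (1 - ‖x‖)⁻¹ * (1 - ‖x‖)⁻¹)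
  rw [zero_mul] at hlim
  refine squeeze_zero_norm (fun k ↦ ?_) hlim
  rw [norm_mul, norm_mul, norm_pow, norm_neg, norm_one, one_pow, one_mul, norm_pow]
  refine mul_le_mul (pow_le_pow_of_le_one (norm_nonneg _) hx.le ?_) ?_ (norm_nonneg _)
    (by positivity)
  · rw [Nat.le_div_iff_mul_le two_pos]
    nlinarith
  · exact tsum_of_norm_bounded ((hasSum_geometric_of_lt_one (norm_nonneg _) hx).mul_left _)
      (norm_pow_mul_prod_one_sub_pow_le hx k)

lemma summable_pentagonal {x : 𝕜} [CompleteSpace 𝕜] (hx : ‖x‖ < 1) :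
    Summable fun k : ℕ ↦ (-1) ^ k * (x ^ pentagonal (-k) - x ^ pentagonal (k + 1)) := by
  refine .of_norm_bounded ((summable_geometric_of_lt_one (norm_nonneg _) hx).mul_left 2)
    fun k ↦ ?_
  rw [norm_mul, norm_pow, norm_neg, norm_one, one_pow, one_mul, two_mul]
  refine (norm_sub_le _ _).trans ?_
  rw [norm_pow, norm_pow]
  exact add_le_add (pow_le_pow_of_le_one (norm_nonneg _) hx.le (le_pentagonal_neg k))
    (pow_le_pow_of_le_one (norm_nonneg _) hx.le (le_pentagonal_add_one k))

theorem tprod_one_sub_pow_eq_tsum {x : 𝕜} [CompleteSpace 𝕜] (hx : ‖x‖ < 1) :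
    ∏' n : ℕ, (1 - x ^ (n + 1)) =
      ∑' k : ℕ, (-1) ^ k * (x ^ pentagonal (-k) - x ^ pentagonal (k + 1)) := by
  have hgeo := summable_geometric_of_lt_one (norm_nonneg _) hx
  refine Pentagonal.tprod_one_sub_pow (tendsto_pow_atTop_nhds_zero_of_norm_lt_one hx)
    (fun k ↦ .of_norm_bounded (hgeo.mul_left _) (norm_pow_mul_prod_one_sub_pow_le hx k))
    (fun k ↦ ?_) (summable_pentagonal hx) (tendsto_pentagonal_remainder hx)
  simp_rw [sub_eq_add_neg]
  refine multipliable_one_add_of_summable ?_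
  simpa only [norm_neg, norm_pow, add_assoc] using (summable_nat_add_iff (k + 1)).mpr hgeo

end Pentagonal

section Eta

lemma chiTwelve_apply (x : ZMod 12) : chiTwelve x = (chiTwelveInt x : ℂ) := rfl

lemma chiTwelve_neg (x : ZMod 12) : chiTwelve (-x) = chiTwelve x := by
  have : ∀ x, chiTwelveInt (-x) = chiTwelveInt x := by decide
  rw [chiTwelve_apply, this, chiTwelve_apply]

lemma chiTwelve_six_mul_add_one (k : ℤ) : chiTwelve ((6 * k + 1 : ℤ) : ZMod 12) = k.negOnePow := by
  have h : ∀ x : ZMod 12, chiTwelveInt (6 * (x + x) + 1) = 1 ∧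
      chiTwelveInt (6 * (2 * x + 1) + 1) = -1 := by decide
  rw [chiTwelve_apply]
  push_cast
  obtain ⟨k, rfl⟩ | ⟨k, rfl⟩ := k.even_or_odd
  · push_cast
    rw [(h k).1, Int.negOnePow_even _ ⟨k, rfl⟩]
    simp
  · push_cast
    rw [(h k).2, Int.negOnePow_odd _ ⟨k, rfl⟩]
    simp

lemma emod_six_of_chiTwelve_ne_zero {n : ℤ} (hn : chiTwelve n ≠ 0) : n % 6 = 1 ∨ n % 6 = 5 := by
  have h : ∀ x : ZMod 12, chiTwelveInt (2 * x) = 0 ∧ chiTwelveInt (3 * x) = 0 := by decide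
  have h2 : ¬ 2 ∣ n := by
    rintro ⟨m, rfl⟩
    simp [chiTwelve_apply, h] at hn
  have h3 : ¬ 3 ∣ n := by
    rintro ⟨m, rfl⟩
    simp [chiTwelve_apply, h] at hn
  lia

lemma tsum_eq_two_mul_tsum_six_mul_add_one {F : ℤ → ℂ} (hF : Summable F)
    (heven : ∀ n, F (-n) = F n) (hsupp : ∀ n, F n ≠ 0 → n % 6 = 1 ∨ n % 6 = 5) :
    ∑' n, F n = 2 * ∑' k : ℤ, F (6 * k + 1) := by
  have hinj : Function.Injective fun k : ℤ ↦ 6 * k + 1 := fun a b h ↦ by simpa using h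
  let e : ℤ ⊕ ℤ → ℤ := Sum.elim (fun k ↦ 6 * k + 1) fun k ↦ -(6 * k + 1)
  have he : Function.Injective e :=
    hinj.sumElim (g := fun k ↦ -(6 * k + 1)) (neg_injective.comp hinj) fun a b ↦ by lia
  have hrange : Function.support F ⊆ Set.range e := fun n hn ↦ by
    rcases hsupp n hn with h | h
    · exact ⟨.inl (n / 6), show 6 * (n / 6) + 1 = n by lia⟩
    · exact ⟨.inr (-n / 6), show -(6 * (-n / 6) + 1) = n by lia⟩
  have hsum := hF.comp_injective hinj
  have hsum' : Summable fun k ↦ F (e (.inr k)) := hsum.congr fun k ↦ (heven _).symm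
  calc ∑' n, F n = ∑' s, F (e s) := (he.tsum_eq hrange).symm
    _ = ∑' k : ℤ, F (6 * k + 1) + ∑' k : ℤ, F (-(6 * k + 1)) := Summable.tsum_sum hsum hsum'
    _ = 2 * ∑' k : ℤ, F (6 * k + 1) := by simp only [heven, two_mul]

lemma qParam_mul_qParam_pow_pentagonal_neg (z : ℂ) (k : ℤ) :
    qParam 24 z * qParam 1 z ^ pentagonal (-k) =
      Complex.exp (2 * π * Complex.I * ((6 * k + 1 : ℤ) : ℂ) ^ 2 * (z / 24)) := by
  have h : (2 * (pentagonal (-k)) : ℂ) = k * (3 * k + 1) := by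
    exact_mod_cast two_mul_natCast_pentagonal_neg k
  rw [qParam, qParam, ← Complex.exp_nat_mul, ← Complex.exp_add]
  congr 1
  push_cast
  field_simp
  linear_combination 12 * z * h

theorem eta_eq_thetaSeries {z : ℂ} (hz : 0 < z.im) :
    eta z = 2⁻¹ * thetaSeries chiTwelve (z / 24) := by
  have hq : ‖qParam 1 z‖ < 1 := by
    simpa using UpperHalfPlane.norm_qParam_lt_one 1 ⟨z, hz⟩
  have hz' : 0 < (z / 24).im := by simpa [Complex.div_im] using by positivity
  have hsum := summable_mul_cexp_sq hz' chiTwelve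
  rw [thetaSeries, tsum_eq_two_mul_tsum_six_mul_add_one hsum
    (fun n ↦ by rw [Int.cast_neg, chiTwelve_neg, Int.cast_neg, neg_sq])
    (fun n hn ↦ emod_six_of_chiTwelve_ne_zero (left_ne_zero_of_mul hn)), inv_mul_cancel_left₀
    two_ne_zero, eta, tprod_one_sub_pow_eq_tsum hq, ← tsum_mul_left]
  have hsum' := hsum.comp_injective (i := fun k : ℤ ↦ 6 * k + 1) fun a b h ↦ by simpa using h
  refine (hsum'.hasSum.nat_add_neg_add_one.congr_fun fun k ↦ ?_).tsum_eq
  have hneg := qParam_mul_qParam_pow_pentagonal_neg z (-(k + 1))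
  rw [neg_neg] at hneg
  simp only [Function.comp_apply, chiTwelve_six_mul_add_one]
  rw [← qParam_mul_qParam_pow_pentagonal_neg z k, ← hneg, Int.negOnePow_neg, Int.negOnePow_succ]
  push_cast [Int.coe_negOnePow]
  rw [Int.natAbs_natCast]
  ring

end Eta

section EtaInversion

lemma not_factorsThrough_chiTwelve {m : ℕ} (hm : m ∣ 12) (u : (ZMod 12)ˣ)
    (hu : ZMod.unitsMap hm u = 1) (hχ : chiTwelveInt u = -1) : ¬ chiTwelve.FactorsThrough m := by
  rw [DirichletCharacter.factorsThrough_iff_ker_unitsMap hm]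
  intro h
  have h1 : chiTwelve u = 1 := by
    rw [← MulChar.coe_toUnitHom, MonoidHom.mem_ker.mp (h (MonoidHom.mem_ker.mpr hu)), Units.val_one]
  rw [chiTwelve_apply, hχ] at h1
  norm_num at h1

lemma isPrimitive_chiTwelve : chiTwelve.IsPrimitive := by
  have h4 : ¬ chiTwelve.FactorsThrough 4 :=
    not_factorsThrough_chiTwelve (by decide) ⟨5, 5, by decide, by decide⟩ (by decide) (by decide)
  have h6 : ¬ chiTwelve.FactorsThrough 6 :=
    not_factorsThrough_chiTwelve (by decide) ⟨7, 7, by decide, by decide⟩ (by decide) (by decide)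
  have hlevel := chiTwelve.conductor_dvd_level
  have h := chiTwelve.factorsThrough_conductor
  have hle := Nat.le_of_dvd (by norm_num) hlevel
  rw [DirichletCharacter.isPrimitive_def]
  by_contra hne
  have hdvd : chiTwelve.conductor ∣ 4 ∨ chiTwelve.conductor ∣ 6 := by
    interval_cases chiTwelve.conductor <;> revert hlevel hne <;> decide
  rcases hdvd with hdvd | hdvd
  · exact h4 (h.mono _ hdvd (by decide))
  · exact h6 (h.mono _ hdvd (by decide))

lemma stdAddChar_add_stdAddChar_neg {N : ℕ} [NeZero N] (j : ℤ) :
    ZMod.stdAddChar (j : ZMod N) + ZMod.stdAddChar (-j : ZMod N) =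
      2 * Real.cos (2 * π * j / N) := by
  rw [← Int.cast_neg, ZMod.stdAddChar_coe, ZMod.stdAddChar_coe, Complex.ofReal_cos, Complex.cos,
    mul_div_cancel₀ _ two_ne_zero]
  push_cast
  ring_nf

lemma gaussSum_chiTwelve : gaussSum chiTwelve ZMod.stdAddChar = √12 := by
  have hsupp : ∀ x : ZMod 12, x ∉ ({1, -1, 5, -5} : Finset (ZMod 12)) → chiTwelveInt x = 0 := by
    decide
  have h1 := stdAddChar_add_stdAddChar_neg (N := 12) 1
  have h5 := stdAddChar_add_stdAddChar_neg (N := 12) 5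
  have hcos1 : Real.cos (2 * π * (1 : ℤ) / (12 : ℕ)) = √3 / 2 := by
    rw [← Real.cos_pi_div_six]
    congr 1
    push_cast
    ring
  have hcos5 : Real.cos (2 * π * (5 : ℤ) / (12 : ℕ)) = -(√3 / 2) := by
    rw [← Real.cos_pi_div_six, ← Real.cos_pi_sub]
    congr 1
    push_cast
    ring
  have h12 : √12 = 2 * √3 := by
    rw [show (12 : ℝ) = 2 ^ 2 * 3 by norm_num, Real.sqrt_mul (by norm_num),
      Real.sqrt_sq (by norm_num)]
  rw [hcos1] at h1
  rw [hcos5] at h5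
  rw [gaussSum, ← Finset.sum_subset (Finset.subset_univ {1, -1, 5, -5}) fun x _ hx ↦ by
    rw [chiTwelve_apply, hsupp x hx, Int.cast_zero, zero_mul]]
  rw [Finset.sum_insert (by decide), Finset.sum_insert (by decide), Finset.sum_insert (by decide),
    Finset.sum_singleton, chiTwelve_neg, chiTwelve_neg, chiTwelve_apply, chiTwelve_apply,
    show chiTwelveInt 1 = 1 by decide, show chiTwelveInt 5 = -1 by decide, h12]
  push_cast at h1 h5 ⊢
  linear_combination h1 - h5

lemma inv_chiTwelve : chiTwelve⁻¹ = chiTwelve :=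
  MulChar.IsQuadratic.inv (.comp (by unfold MulChar.IsQuadratic; decide) _)

lemma dft_chiTwelve : ZMod.dft (chiTwelve : ZMod 12 → ℂ) = fun k ↦ √12 * chiTwelve k := by
  funext k
  rw [isPrimitive_chiTwelve.fourierTransform_eq_inv_mul_gaussSum, inv_chiTwelve, chiTwelve_neg,
    gaussSum_chiTwelve, mul_comm]

lemma dft_chiTwelve_mul (a : ZMod 12) :
    ZMod.dft (fun x : ZMod 12 ↦ chiTwelve (a * x)) = fun x ↦ chiTwelve a * √12 * chiTwelve x := by
  simp only [map_mul]
  rw [ZMod.dft_const_mul, dft_chiTwelve]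
  simp only [mul_assoc]

theorem eta_inversion {d : ℕ} [NeZero d] (h : Nat.Coprime 12 d) {b b' : ℤ}
    (hb : (d : ℤ) ∣ 576 * b * b' + 1) {σ : ℂ} (hσ : 0 < σ.im) :
    eta ((24 * b - 1 / σ) / d) = chiTwelve d * (quadGauss (b : ZMod d) / √d) *
      (-Complex.I * σ) ^ (1 / 2 : ℂ) * eta ((σ + 24 * b') / d) := by
  have hd : (0 : ℝ) < d := Nat.cast_pos.mpr (NeZero.pos d)
  have hσ' : 0 < (24 * σ).im := by simpa using hσ
  have him1 : 0 < ((24 * b - 1 / σ) / d).im := by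
    rw [Complex.div_natCast_im]
    refine div_pos ?_ hd
    simpa [neg_div] using neg_ofReal_div_im_pos one_pos hσ
  have him2 : 0 < ((σ + 24 * b') / d).im := by
    rw [Complex.div_natCast_im]
    exact div_pos (by simpa using hσ) hd
  have e1 : (24 * b - 1 / σ) / d / 24 = (b - 1 / (24 * σ)) / d := by field_simp
  have e2 : (24 * σ / (4 * ((12 : ℕ) : ℂ) ^ 2) + b') / d = (σ + 24 * b') / d / 24 := by
    push_cast
    field_simp
    ring
  have e3 : -Complex.I * (24 * σ) = ((24 : ℝ) : ℂ) * (-Complex.I * σ) := by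
    push_cast
    ring
  have hc : (√24 * √12 : ℂ) = √2 * 12 := by
    norm_cast
    rw [show (24 : ℝ) = 2 * 12 by norm_num, Real.sqrt_mul zero_le_two, mul_assoc,
      Real.mul_self_sqrt (by norm_num)]
  have h2 : ((√2 : ℝ) : ℂ) ≠ 0 := by simp
  rw [eta_eq_thetaSeries him1, eta_eq_thetaSeries him2, e1,
    thetaSeries_inversion h _ (by push_cast; convert hb using 3) hσ', e2, dft_chiTwelve_mul,
    thetaSeries_const_mul, e3, ofReal_mul_cpow_half (by norm_num)]
  push_cast
  field_simp
  linear_combination (chiTwelve d * quadGauss (b : ZMod d) * (-(Complex.I * σ)) ^ (1 / 2 : ℂ) *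
    thetaSeries chiTwelve ((σ + 24 * b') / (24 * d)) * (√d : ℂ)⁻¹) * hc

lemma jacobiTheta_eq_thetaSeries (w : ℂ) :
    jacobiTheta (2 * w) = thetaSeries (fun _ : ZMod 1 ↦ 1) w := by
  refine tsum_congr fun n ↦ ?_
  rw [one_mul]
  congr 1
  ring

theorem jacobiTheta_inversion {d : ℕ} [NeZero d] {b b' : ℤ}
    (hb : (d : ℤ) ∣ 4 * b * b' + 1) {σ : ℂ} (hσ : 0 < σ.im) :
    jacobiTheta (2 * ((b - 1 / σ) / d)) = (√2 : ℂ)⁻¹ * (quadGauss (b : ZMod d) / √d) *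
      (-Complex.I * σ) ^ (1 / 2 : ℂ) * jacobiTheta (2 * ((σ / 4 + b') / d)) := by
  have hdft : ZMod.dft (fun _ : ZMod 1 ↦ (1 : ℂ)) = fun _ ↦ 1 := by
    funext k
    rw [ZMod.dft_apply]
    simp [Subsingleton.elim _ (0 : ZMod 1)]
  rw [jacobiTheta_eq_thetaSeries, jacobiTheta_eq_thetaSeries,
    thetaSeries_inversion (Nat.coprime_one_left d) _ (by simpa using hb) hσ, hdft]
  simp only [Nat.cast_one, one_pow, mul_one]

end EtaInversion

section ThetaNeZero

/-- The three Jacobi theta constants do not vanish at `τ`. They are given as the values of one of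
them at `τ`, `τ + 1` and `1 - 1 / τ`, points that `SL₂(ℤ)` permutes up to nonzero factors, whereas
the nonvanishing of `jacobiTheta` alone is not visibly invariant under `τ ↦ τ + 1`. -/
def ThetaConstantsNeZero (τ : ℍ) : Prop :=
  jacobiTheta τ ≠ 0 ∧ jacobiTheta (τ + 1) ≠ 0 ∧ jacobiTheta (1 - 1 / τ) ≠ 0

lemma neg_I_mul_ne_zero {z : ℂ} (hz : 0 < z.im) : -Complex.I * z ≠ 0 :=
  mul_ne_zero (neg_ne_zero.mpr Complex.I_ne_zero) fun h ↦ by simp [h] at hz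

lemma neg_one_div_im_pos {z : ℂ} (hz : 0 < z.im) : 0 < (-1 / z).im := by
  simpa only [Complex.ofReal_one] using neg_ofReal_div_im_pos one_pos hz

lemma jacobiTheta_neg_one_div_eq_zero_iff {z : ℂ} (hz : 0 < z.im) :
    jacobiTheta (-1 / z) = 0 ↔ jacobiTheta z = 0 := by
  have h := jacobiTheta_S_smul ⟨z, hz⟩
  rw [modular_S_smul] at h
  simp only at h
  rw [show -1 / z = (-z)⁻¹ by rw [inv_neg, neg_div, one_div], h, mul_eq_zero, or_iff_right]
  rw [Complex.cpow_eq_zero_iff]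
  exact fun hc ↦ neg_I_mul_ne_zero hz hc.1

lemma jacobiTheta_one_sub_inv_add_one_eq_zero_iff {z : ℂ} (hz : 0 < z.im) :
    jacobiTheta (1 - 1 / (z + 1)) = 0 ↔ jacobiTheta (1 - 1 / z) = 0 := by
  have hz0 : z ≠ 0 := fun h ↦ by simp [h] at hz
  have hz1 : z + 1 ≠ 0 := fun h ↦ by simp [eq_neg_of_add_eq_zero_left h] at hz
  have him : 0 < (1 - 1 / (z + 1)).im := by
    have h := neg_one_div_im_pos (z := z + 1) (by simpa using hz)
    rw [sub_eq_add_neg, ← neg_div]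
    simpa using h
  have hS : 2 + -1 / (1 - 1 / (z + 1)) = 1 - 1 / z := by
    rw [show 1 - 1 / (z + 1) = z / (z + 1) by field_simp; ring]
    field_simp
    ring
  rw [← jacobiTheta_neg_one_div_eq_zero_iff him, ← jacobiTheta_two_add, hS]

lemma thetaConstantsNeZero_T_smul (τ : ℍ) :
    ThetaConstantsNeZero (ModularGroup.T • τ) ↔ ThetaConstantsNeZero τ := by
  have hT : ((ModularGroup.T • τ : ℍ) : ℂ) = τ + 1 := by
    rw [modular_T_smul, coe_vadd, Complex.ofReal_one, add_comm]
  have hadd : jacobiTheta (τ + 1 + 1) = jacobiTheta τ := by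
    rw [show (τ + 1 + 1 : ℂ) = 2 + τ by ring, jacobiTheta_two_add]
  rw [ThetaConstantsNeZero, ThetaConstantsNeZero, hT, hadd, Ne, Ne, Ne,
    jacobiTheta_one_sub_inv_add_one_eq_zero_iff τ.im_pos]
  tauto

lemma thetaConstantsNeZero_S_smul (τ : ℍ) :
    ThetaConstantsNeZero (ModularGroup.S • τ) ↔ ThetaConstantsNeZero τ := by
  have hτ := τ.ne_zero
  have hS : ((ModularGroup.S • τ : ℍ) : ℂ) = -1 / τ := by
    rw [modular_S_smul, coe_mk, inv_neg, neg_div, one_div]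
  have h1 : (-1 / τ + 1 : ℂ) = 1 - 1 / τ := by ring
  have h2 : (1 - 1 / (-1 / τ) : ℂ) = τ + 1 := by
    field_simp [hτ]
    ring
  rw [ThetaConstantsNeZero, ThetaConstantsNeZero, hS, h1, h2, Ne, Ne, Ne,
    jacobiTheta_neg_one_div_eq_zero_iff τ.im_pos]
  tauto

lemma thetaConstantsNeZero_smul (γ : SL(2, ℤ)) (τ : ℍ) :
    ThetaConstantsNeZero (γ • τ) ↔ ThetaConstantsNeZero τ := by
  have hγ : γ ∈ Subgroup.closure {ModularGroup.S, ModularGroup.T} := by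
    rw [SpecialLinearGroup.SL2Z_generators]
    trivial
  induction hγ using Subgroup.closure_induction generalizing τ with
  | mem x hx =>
    rcases hx with rfl | rfl
    · exact thetaConstantsNeZero_S_smul τ
    · exact thetaConstantsNeZero_T_smul τ
  | one => rw [one_smul]
  | mul x y _ _ hx hy => exact (mul_smul x y τ ▸ hx (y • τ)).trans (hy τ)
  | inv x _ hx => exact (smul_inv_smul x τ ▸ hx (x⁻¹ • τ)).symm

lemma exp_neg_pi_mul_lt_one_third {y : ℝ} (hy : 3 / 4 < y) : Real.exp (-π * y) < 1 / 3 := by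
  have h1 : 2 < π * y := by nlinarith [Real.pi_gt_three]
  have h2 : 3 < Real.exp (π * y) := by linarith [Real.add_one_lt_exp (x := π * y) (by linarith)]
  rw [neg_mul, Real.exp_neg, one_div]
  exact inv_strictAnti₀ three_pos h2

lemma jacobiTheta_ne_zero_of_im {z : ℂ} (hz : 3 / 4 < z.im) : jacobiTheta z ≠ 0 := by
  intro h
  have hx := exp_neg_pi_mul_lt_one_third hz
  have hle := norm_jacobiTheta_sub_one_le (τ := z) (by linarith)
  rw [h, zero_sub, norm_neg, norm_one, div_mul_eq_mul_div, le_div_iff₀ (by linarith)] at hle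
  linarith

lemma jacobiTheta_one_add (z : ℂ) : jacobiTheta (1 + z) = jacobiTheta₂ (1 / 2) z := by
  rw [jacobiTheta_eq_jacobiTheta₂]
  refine tsum_congr fun n ↦ ?_
  rw [jacobiTheta₂_term, jacobiTheta₂_term, Complex.exp_eq_exp_iff_exists_int]
  obtain ⟨k, hk⟩ := Int.even_mul_succ_self (n - 1)
  have hk' : ((n : ℂ) - 1) * n = k + k := by
    rw [sub_add_cancel] at hk
    exact_mod_cast hk
  exact ⟨k, by linear_combination (π * Complex.I) * hk'⟩

lemma jacobiTheta₂_term_half (n : ℤ) (z : ℂ) :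
    jacobiTheta₂_term n (z / 2) z = Complex.exp (π * Complex.I * ((n * (n + 1) : ℤ) : ℂ) * z) := by
  rw [jacobiTheta₂_term]
  congr 1
  push_cast
  ring

lemma hasSum_nat_jacobiTheta₂_half {z : ℂ} (hz : 0 < z.im) :
    HasSum (fun n : ℕ ↦ jacobiTheta₂_term n (z / 2) z) (jacobiTheta₂ (z / 2) z / 2) := by
  have hreflect (n : ℕ) :
      jacobiTheta₂_term (-(n + 1)) (z / 2) z = jacobiTheta₂_term n (z / 2) z := by
    rw [jacobiTheta₂_term_half, jacobiTheta₂_term_half]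
    congr 4
    ring
  have hsum := (hasSum_jacobiTheta₂_term (z / 2) hz).nat_add_neg_add_one.div_const 2
  simpa only [hreflect, add_self_div_two] using hsum

lemma norm_jacobiTheta₂_term_half_succ_le {z : ℂ} (hz : 0 < z.im) (n : ℕ) :
    ‖jacobiTheta₂_term ((n + 1 : ℕ) : ℤ) (z / 2) z‖ ≤
      Real.exp (-π * z.im) * Real.exp (-π * z.im) ^ n := by
  have hre : (π * Complex.I * ((((n + 1 : ℕ) : ℤ) * (((n + 1 : ℕ) : ℤ) + 1) : ℤ) : ℂ) * z).re =
      (n + 1) * (n + 2) * (-π * z.im) := by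
    rw [mul_right_comm, ← Complex.ofReal_intCast, Complex.re_mul_ofReal, mul_assoc,
      Complex.re_ofReal_mul, Complex.I_mul_re]
    push_cast
    ring
  rw [jacobiTheta₂_term_half, Complex.norm_exp, ← pow_succ', ← Real.exp_nat_mul, Real.exp_le_exp,
    hre]
  refine mul_le_mul_of_nonpos_right ?_ (by nlinarith [Real.pi_pos])
  push_cast
  nlinarith

lemma jacobiTheta₂_half_ne_zero {z : ℂ} (hz : 3 / 4 < z.im) : jacobiTheta₂ (z / 2) z ≠ 0 := by
  intro h
  have hz' : 0 < z.im := by linarith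
  have hx := exp_neg_pi_mul_lt_one_third hz
  have htail := (hasSum_nat_add_iff' 1).mpr (hasSum_nat_jacobiTheta₂_half hz')
  rw [Finset.sum_range_one, jacobiTheta₂_term_half, h] at htail
  simp only [Nat.cast_zero, zero_mul, Int.cast_zero, mul_zero, Complex.exp_zero, zero_div,
    zero_sub] at htail
  have hle := htail.norm_le_of_bounded
    ((hasSum_geometric_of_lt_one (Real.exp_pos _).le (by linarith)).mul_left _)
    (norm_jacobiTheta₂_term_half_succ_le hz')
  rw [norm_neg, norm_one, ← div_eq_mul_inv, le_div_iff₀ (by linarith)] at hle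
  linarith

lemma jacobiTheta_one_sub_inv_ne_zero {z : ℂ} (hz : 3 / 4 < z.im) :
    jacobiTheta (1 - 1 / z) ≠ 0 := by
  have hz0 : z ≠ 0 := fun h ↦ by norm_num [h] at hz
  have h := jacobiTheta₂_functional_equation (z / 2) z
  rw [show z / 2 / z = 1 / 2 by field_simp] at h
  rw [sub_eq_add_neg, ← neg_div, jacobiTheta_one_add]
  exact right_ne_zero_of_mul (h ▸ jacobiTheta₂_half_ne_zero hz)

lemma thetaConstantsNeZero (τ : ℍ) : ThetaConstantsNeZero τ := by
  obtain ⟨γ, hγ⟩ := ModularGroup.exists_smul_mem_fd τ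
  rw [← thetaConstantsNeZero_smul γ]
  have him : 3 / 4 < ((γ • τ : ℍ) : ℂ).im := by
    rw [coe_im]
    nlinarith [ModularGroup.three_le_four_mul_im_sq_of_mem_fd hγ, (γ • τ).im_pos]
  exact ⟨jacobiTheta_ne_zero_of_im him, jacobiTheta_ne_zero_of_im (by simpa using him),
    jacobiTheta_one_sub_inv_ne_zero him⟩

theorem theta_ne_zero (τ : ℍ) : theta τ ≠ 0 := by
  simpa [theta, dilate] using (thetaConstantsNeZero (dilate 2 τ)).1

end ThetaNeZero

section Transformation

lemma coe_smul_of_pos (γ : SL(2, ℤ)) {d : ℕ} [NeZero d] (hd : γ 1 1 = d) (τ : ℍ) :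
    ((γ • τ : ℍ) : ℂ) = (γ 0 1 - 1 / (-(γ 1 0 + d / τ))) / d := by
  have hdet := Matrix.SpecialLinearGroup.det_coe γ
  rw [Matrix.det_fin_two, hd] at hdet
  have hdet' : (γ 0 0 : ℂ) * d - γ 0 1 * γ 1 0 = 1 := by exact_mod_cast hdet
  have hτ := τ.ne_zero
  have hdC : (d : ℂ) ≠ 0 := NeZero.ne _
  have hden : τ * (γ 1 0 : ℂ) + d ≠ 0 := by
    simpa [denom, hd, mul_comm] using denom_ne_zero γ τ
  rw [specialLinearGroup_apply, show -(γ 1 0 + d / τ : ℂ) = -((τ * γ 1 0 + d) / τ) by field_simp]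
  simp only [eq_intCast, hd]
  push_cast
  field_simp
  linear_combination (τ : ℂ) * hdet'

lemma quadGauss_one (b : ZMod 1) : quadGauss b = 1 := by
  rw [quadGauss, Fintype.sum_unique, Subsingleton.elim (b * _) 0, AddChar.map_zero_eq_one]

lemma eta_neg_one_div {σ : ℂ} (hσ : 0 < σ.im) :
    eta (-1 / σ) = (-Complex.I * σ) ^ (1 / 2 : ℂ) * eta σ := by
  have h := eta_inversion (d := 1) (by norm_num) (b := 0) (b' := 0) (by norm_num) hσ
  simpa [quadGauss_one, neg_div] using h

lemma jacobiTheta_neg_one_div_four_mul {σ : ℂ} (hσ : 0 < σ.im) :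
    jacobiTheta (2 * (-1 / (4 * σ))) =
      √2 * (-Complex.I * σ) ^ (1 / 2 : ℂ) * jacobiTheta (2 * σ) := by
  have h := jacobiTheta_inversion (d := 1) (b := 0) (b' := 0) (by norm_num) (σ := 4 * σ)
    (by simpa using hσ)
  have h4 : √4 = √2 * √2 := by
    rw [← Real.sqrt_mul zero_le_two]
    norm_num
  have h2 : ((√2 : ℝ) : ℂ) ≠ 0 := by simp
  rw [show -Complex.I * (4 * σ) = ((4 : ℝ) : ℂ) * (-Complex.I * σ) by push_cast; ring,
    ofReal_mul_cpow_half (by norm_num), h4, mul_div_cancel_left₀ σ (by norm_num : (4 : ℂ) ≠ 0)] at h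
  simp only [Int.cast_zero, zero_sub, Nat.cast_one, div_one, quadGauss_one, add_zero,
    Real.sqrt_one, Complex.ofReal_one, mul_one, Complex.ofReal_mul, ← neg_div] at h
  rw [h]
  field_simp

lemma neg_add_div_im_pos (c : ℤ) (d : ℕ) [NeZero d] (τ : ℍ) :
    0 < (-(c + d / τ) : ℂ).im := by
  have h := neg_ofReal_div_im_pos (c := d) (Nat.cast_pos.mpr (NeZero.pos d)) τ.im_pos
  rw [neg_add, ← neg_div, Complex.add_im, Complex.neg_im, Complex.intCast_im]
  simpa using h

variable {γ : SL(2, ℤ)} {c : ℤ} {d : ℕ} [NeZero d]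

lemma theta_smul_of_pos (hc : γ 1 0 = 4 * c) (hd : γ 1 1 = d) (τ : ℍ) :
    theta (γ • τ) = quadGauss (γ 0 1 : ZMod d) / √d *
      (-Complex.I * -(γ 1 0 + d / τ)) ^ (1 / 2 : ℂ) * (-Complex.I * τ) ^ (1 / 2 : ℂ) *
        theta τ := by
  have hdC : (d : ℂ) ≠ 0 := NeZero.ne _
  have hτ := τ.ne_zero
  have hdet := Matrix.SpecialLinearGroup.det_coe γ
  rw [Matrix.det_fin_two, hd, hc] at hdet
  have hpoint : (-(γ 1 0 + d / τ : ℂ) / 4 + c) / d = -1 / (4 * (τ : ℂ)) := by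
    rw [hc]
    push_cast
    field_simp
    ring
  have hθ := jacobiTheta_inversion (b := γ 0 1) (b' := c) (d := d)
    ⟨γ 0 0, by linear_combination -hdet⟩ (neg_add_div_im_pos (γ 1 0) d τ)
  rw [← coe_smul_of_pos γ hd, hpoint, jacobiTheta_neg_one_div_four_mul τ.im_pos] at hθ
  have h2 : ((√2 : ℝ) : ℂ) ≠ 0 := by simp
  rw [theta, theta, hθ]
  field_simp

lemma eta_smul_of_pos (hc : γ 1 0 = 576 * c) (hd : γ 1 1 = d) (τ : ℍ) :
    eta (24 * ((γ • τ : ℍ) : ℂ)) = chiTwelve d * (quadGauss (γ 0 1 : ZMod d) / √d) *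
      (-Complex.I * -(γ 1 0 + d / τ)) ^ (1 / 2 : ℂ) * (-Complex.I * τ) ^ (1 / 2 : ℂ) *
        eta (24 * (τ : ℂ)) := by
  have hdC : (d : ℂ) ≠ 0 := NeZero.ne _
  have hτ := τ.ne_zero
  have hdet := Matrix.SpecialLinearGroup.det_coe γ
  rw [Matrix.det_fin_two, hd, hc] at hdet
  have hcop : Nat.Coprime 12 d := by
    rw [← Nat.isCoprime_iff_coprime]
    exact ⟨-48 * γ 0 1 * c, γ 0 0, by push_cast; linear_combination hdet⟩
  have hσ := neg_add_div_im_pos (γ 1 0) d τ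
  have hγτ := coe_smul_of_pos γ hd τ
  have hpoint : (-(γ 1 0 + d / τ : ℂ) / 24 + 24 * c) / d = -1 / (24 * (τ : ℂ)) := by
    rw [hc]
    push_cast
    field_simp
    ring
  set σ : ℂ := -(γ 1 0 + d / τ)
  have hσ0 : σ ≠ 0 := fun h ↦ by simp [h] at hσ
  have h24 : 24 * ((γ • τ : ℍ) : ℂ) = (24 * γ 0 1 - 1 / (σ / 24)) / d := by
    rw [hγτ]
    field_simp
  have hη := eta_inversion hcop (b := γ 0 1) (b' := c) ⟨γ 0 0, by linear_combination -hdet⟩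
    (σ := σ / 24) (by simpa using hσ)
  rw [← h24, hpoint, eta_neg_one_div (by simpa using τ.im_pos),
    show -Complex.I * (σ / 24) = ((1 / 24 : ℝ) : ℂ) * (-Complex.I * σ) by push_cast; ring,
    show -Complex.I * (24 * τ) = ((24 : ℝ) : ℂ) * (-Complex.I * τ) by push_cast; ring,
    ofReal_mul_cpow_half (by norm_num), ofReal_mul_cpow_half (by norm_num)] at hη
  have hs : ((√(1 / 24) : ℝ) : ℂ) * (√24 : ℝ) = 1 := by
    rw [← Complex.ofReal_mul, ← Real.sqrt_mul (by norm_num)]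
    norm_num
  rw [hη]
  linear_combination (chiTwelve d * (quadGauss (γ 0 1 : ZMod d) / √d) *
    (-Complex.I * σ) ^ (1 / 2 : ℂ) * (-Complex.I * τ) ^ (1 / 2 : ℂ) * eta (24 * τ)) * hs

lemma eta_smul_eq_thetaFactor_of_pos (hc : γ 1 0 = 576 * c) (hd : γ 1 1 = d) (τ : ℍ) :
    eta (24 * ((γ • τ : ℍ) : ℂ)) = chiTwelve d * thetaFactor γ τ * eta (24 * (τ : ℂ)) := by
  have hθ := theta_ne_zero τ
  rw [thetaFactor, eta_smul_of_pos hc hd, theta_smul_of_pos (c := 144 * c) (by rw [hc]; ring) hd]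
  field_simp

end Transformation

lemma lower_right_ne_zero_of_mem_Gamma0 {N : ℕ} (hN : N ≠ 1) {γ : SL(2, ℤ)}
    (hγ : γ ∈ CongruenceSubgroup.Gamma0 N) : γ 1 1 ≠ 0 := by
  intro hd
  have hdet := Matrix.SpecialLinearGroup.det_coe γ
  rw [Matrix.det_fin_two, hd, mul_zero, zero_sub] at hdet
  have hdvd : (N : ℤ) ∣ 1 := by
    rw [← hdet]
    exact ((ZMod.intCast_zmod_eq_zero_iff_dvd _ _).mp
      (CongruenceSubgroup.Gamma0_mem.mp hγ)).mul_left _ |>.neg_right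
  exact hN (Nat.dvd_one.mp (by exact_mod_cast hdvd))

theorem eta_smul {γ : SL(2, ℤ)} (hγ : γ ∈ CongruenceSubgroup.Gamma0 576) (τ : ℍ) :
    eta (24 * ((γ • τ : ℍ) : ℂ)) =
      chiTwelve (γ 1 1 : ZMod 12) * thetaFactor γ τ * eta (24 * (τ : ℂ)) := by
  obtain ⟨c, hc⟩ := (ZMod.intCast_zmod_eq_zero_iff_dvd _ _).mp (CongruenceSubgroup.Gamma0_mem.mp hγ)
  have h0 := lower_right_ne_zero_of_mem_Gamma0 (by norm_num) hγ
  have : NeZero (γ 1 1).natAbs := ⟨Int.natAbs_ne_zero.mpr h0⟩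
  rcases Int.natAbs_eq (γ 1 1) with hd | hd
  · rw [eta_smul_eq_thetaFactor_of_pos hc hd, hd, Int.cast_natCast, Int.natAbs_natCast]
  · have h := eta_smul_eq_thetaFactor_of_pos (γ := -γ) (c := -c) (d := (γ 1 1).natAbs)
      (by simp [hc]) (by simpa using neg_eq_iff_eq_neg.mpr hd) τ
    rw [thetaFactor, ModularGroup.SL_neg_smul, ← thetaFactor] at h
    rw [hd, Int.cast_neg, chiTwelve_neg, Int.cast_natCast, h]

section GaussFourthPower

lemma quadGauss_mul_quadGauss_neg {d : ℕ} [NeZero d] (hd : Odd d) {b : ZMod d} (hb : IsUnit b) :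
    quadGauss b * quadGauss (-b) = d := by
  have h2 : IsUnit (2 : ZMod d) := by
    simpa using (ZMod.isUnit_iff_coprime 2 d).mpr (Nat.coprime_two_left.mpr hd)
  have hshift (y : ZMod d) : ∑ x, ZMod.stdAddChar (b * x ^ 2) * ZMod.stdAddChar (-b * y ^ 2) =
      ∑ u, ZMod.stdAddChar (b * u ^ 2) * ZMod.stdAddChar (y * (2 * b * u)) := by
    rw [← Equiv.sum_comp (Equiv.addRight y)]
    refine Finset.sum_congr rfl fun u _ ↦ ?_
    rw [← AddChar.map_add_eq_mul, ← AddChar.map_add_eq_mul, Equiv.coe_addRight]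
    congr 1
    ring
  rw [quadGauss, quadGauss, Finset.sum_mul_sum, Finset.sum_comm]
  simp_rw [hshift]
  rw [Finset.sum_comm]
  simp_rw [← Finset.mul_sum, AddChar.sum_mulShift _ (ZMod.isPrimitive_stdAddChar d),
    (h2.mul hb).mul_right_eq_zero]
  simp [ZMod.card]

lemma quadGauss_sq {d : ℕ} [NeZero d] (b : ZMod d) :
    quadGauss b ^ 2 = ∑ x : ZMod d × ZMod d, ZMod.stdAddChar (b * (x.1 ^ 2 + x.2 ^ 2)) := by
  rw [quadGauss, pow_two, Finset.sum_mul_sum, ← Finset.univ_product_univ, Finset.sum_product]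
  refine Finset.sum_congr rfl fun x _ ↦ Finset.sum_congr rfl fun y _ ↦ ?_
  rw [← AddChar.map_add_eq_mul, mul_add]

/-- The similitude `(x, y) ↦ (p x - q y, q x + p y)` multiplies `x² + y²` by `p² + q²`. -/
lemma quadGauss_sq_add_sq_mul_sq {d : ℕ} [NeZero d] {p q : ZMod d} (h : IsUnit (p ^ 2 + q ^ 2))
    (b : ZMod d) : quadGauss ((p ^ 2 + q ^ 2) * b) ^ 2 = quadGauss b ^ 2 := by
  have hinj : Function.Injective fun x : ZMod d × ZMod d ↦
      (p * x.1 - q * x.2, q * x.1 + p * x.2) := by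
    rintro ⟨x, y⟩ ⟨x', y'⟩ hxy
    obtain ⟨h1, h2⟩ := Prod.mk.inj hxy
    refine Prod.ext (h.mul_left_cancel ?_) (h.mul_left_cancel ?_)
    · linear_combination p * h1 + q * h2
    · linear_combination p * h2 - q * h1
  rw [quadGauss_sq, quadGauss_sq, ← (Finite.injective_iff_bijective.mp hinj).sum_comp
    fun x ↦ ZMod.stdAddChar (b * (x.1 ^ 2 + x.2 ^ 2))]
  refine Finset.sum_congr rfl fun x _ ↦ congrArg _ ?_
  ring

lemma exists_sq_add_sq_eq_neg_one {d : ℕ} (hd : Odd d) : ∃ p q : ZMod d, p ^ 2 + q ^ 2 = -1 := by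
  have : NeZero d := ⟨hd.pos.ne'⟩
  have hcop : Nat.Coprime 4 d := Nat.Coprime.pow_left 2 (Nat.coprime_two_left.mpr hd)
  -- A prime `P ≡ 1 (mod 4)`, hence a sum of two squares, with `P ≡ -1 (mod d)`.
  let e := ZMod.chineseRemainder hcop
  have hunit : IsUnit (e.symm (1, -1)) :=
    (Prod.isUnit_iff.mpr ⟨isUnit_one, isUnit_one.neg⟩).map e.symm
  obtain ⟨P, -, hP, hPe⟩ := Nat.forall_exists_prime_gt_and_eq_mod hunit 0
  obtain ⟨hP4, hPd⟩ : (P : ZMod 4) = 1 ∧ (P : ZMod d) = -1 := by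
    rw [← Prod.mk.injEq, ← e.apply_symm_apply (1, -1), ← hPe, map_natCast]
    rfl
  have : Fact P.Prime := ⟨hP⟩
  have hP4' : P % 4 = 1 := (ZMod.natCast_eq_natCast_iff' P 1 4).mp (by simpa using hP4)
  obtain ⟨p, q, hpq⟩ := Nat.Prime.sq_add_sq (p := P) (by omega)
  exact ⟨p, q, by rw [← hPd, ← hpq]; push_cast; rfl⟩

theorem quadGauss_pow_four {d : ℕ} [NeZero d] (hd : Odd d) {b : ZMod d} (hb : IsUnit b) :
    quadGauss b ^ 4 = (d : ℂ) ^ 2 := by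
  obtain ⟨p, q, hpq⟩ := exists_sq_add_sq_eq_neg_one hd
  have hneg := quadGauss_sq_add_sq_mul_sq (hpq ▸ isUnit_one.neg) b
  rw [hpq, neg_one_mul] at hneg
  rw [← quadGauss_mul_quadGauss_neg hd hb, mul_pow, hneg, ← pow_add]

end GaussFourthPower

section ThetaFactor

variable {γ : SL(2, ℤ)} {c : ℤ}

lemma cpow_half_sq (z : ℂ) : (z ^ (1 / 2 : ℂ)) ^ 2 = z := by
  rw [← Complex.cpow_nat_mul, Nat.cast_ofNat, mul_one_div_cancel two_ne_zero, Complex.cpow_one]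

lemma thetaFactor_neg (γ : SL(2, ℤ)) (τ : ℍ) : thetaFactor (-γ) τ = thetaFactor γ τ := by
  rw [thetaFactor, ModularGroup.SL_neg_smul, thetaFactor]

lemma thetaFactor_pow_four_of_pos (hc : γ 1 0 = 4 * c) {d : ℕ} [NeZero d] (hd : γ 1 1 = d)
    (τ : ℍ) : thetaFactor γ τ ^ 4 = ((γ 1 0 : ℂ) * τ + γ 1 1) ^ 2 := by
  have hdet := Matrix.SpecialLinearGroup.det_coe γ
  rw [Matrix.det_fin_two, hd, hc] at hdet
  have hodd : Odd d := by
    rw [← Nat.not_even_iff_odd]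
    rintro ⟨e, rfl⟩
    push_cast at hdet
    exact absurd (show 2 * (γ 0 0 * e - γ 0 1 * 2 * c) = 1 by linear_combination hdet) (by omega)
  have hb : IsUnit (γ 0 1 : ZMod d) := by
    have hdet' := congrArg (Int.cast : ℤ → ZMod d) hdet
    push_cast [ZMod.natCast_self] at hdet'
    exact IsUnit.of_mul_eq_one (-(4 * c)) (by linear_combination hdet')
  have hdC : (d : ℂ) ≠ 0 := NeZero.ne _
  have hτ := τ.ne_zero
  rw [thetaFactor, theta_smul_of_pos hc hd, mul_div_cancel_right₀ _ (theta_ne_zero τ), mul_pow,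
    mul_pow, div_pow, quadGauss_pow_four hodd hb]
  rw [show (4 : ℕ) = 2 * 2 from rfl, pow_mul (Complex.ofReal _), pow_mul _ 2 2, pow_mul _ 2 2,
    cpow_half_sq, cpow_half_sq, ← Complex.ofReal_pow, Real.sq_sqrt (Nat.cast_nonneg _),
    Complex.ofReal_natCast, div_self (pow_ne_zero 2 hdC), one_mul, ← mul_pow, hd]
  congr 1
  push_cast
  field_simp
  linear_combination (-((γ 1 0 : ℂ) * τ + d)) * Complex.I_sq

theorem thetaFactor_pow_four (hγ : γ ∈ CongruenceSubgroup.Gamma0 4) (τ : ℍ) :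
    thetaFactor γ τ ^ 4 = ((γ 1 0 : ℂ) * τ + γ 1 1) ^ 2 := by
  obtain ⟨c, hc⟩ := (ZMod.intCast_zmod_eq_zero_iff_dvd _ _).mp (CongruenceSubgroup.Gamma0_mem.mp hγ)
  have : NeZero (γ 1 1).natAbs :=
    ⟨Int.natAbs_ne_zero.mpr (lower_right_ne_zero_of_mem_Gamma0 (by norm_num) hγ)⟩
  rcases Int.natAbs_eq (γ 1 1) with hd | hd
  · exact thetaFactor_pow_four_of_pos hc hd τ
  · have h := thetaFactor_pow_four_of_pos (γ := -γ) (c := -c) (d := (γ 1 1).natAbs)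
      (by simp [hc]) (by simpa using neg_eq_iff_eq_neg.mpr hd) τ
    rw [← thetaFactor_neg, h, Matrix.SpecialLinearGroup.coe_neg, Matrix.neg_apply,
      Matrix.neg_apply]
    push_cast
    ring

end ThetaFactor

section LevelRaising

variable (d : ℕ) [NeZero d]

lemma coe_dilate (τ : ℍ) : (dilate d τ : ℂ) = d * τ := rfl

/-- The matrix `(d 0; 0 1)`, which acts on the upper half plane as `dilate d`. -/
def dilateMatrix : GL (Fin 2) ℝ :=
  Matrix.GeneralLinearGroup.mkOfDetNeZero !![(d : ℝ), 0; 0, 1] (by simp [NeZero.ne d])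

lemma det_dilateMatrix_pos : 0 < (dilateMatrix d).det.val := by
  simpa [dilateMatrix, Matrix.GeneralLinearGroup.mkOfDetNeZero] using NeZero.pos d

lemma dilateMatrix_smul (τ : ℍ) : dilateMatrix d • τ = dilate d τ := by
  ext
  rw [coe_smul_of_det_pos (det_dilateMatrix_pos d), coe_dilate]
  simp [num, denom, dilateMatrix, Matrix.GeneralLinearGroup.mkOfDetNeZero]

lemma isCusp_dilateMatrix_mul_smul (α : SL(2, ℤ)) :
    IsCusp ((dilateMatrix d * Matrix.SpecialLinearGroup.mapGL ℝ α) • OnePoint.infty) 𝒮ℒ := by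
  rw [isCusp_SL2Z_iff, OnePoint.smul_infty_eq_ite]
  split_ifs
  · exact ⟨OnePoint.infty, rfl⟩
  · refine ⟨((d * α 0 0 / α 1 0 : ℚ) : OnePoint ℚ), ?_⟩
    rw [OnePoint.map_some]
    simp [dilateMatrix, Matrix.GeneralLinearGroup.mkOfDetNeZero, Matrix.mul_apply,
      Fin.sum_univ_two]

lemma slash_dilateMatrix_mul {w : ℤ} (f : ℍ → ℂ) (α : SL(2, ℤ)) (τ : ℍ) :
    (f ∣[w] (dilateMatrix d * Matrix.SpecialLinearGroup.mapGL ℝ α)) τ =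
      (d : ℂ) ^ (w - 1) * (f (dilate d (α • τ)) * (α 1 0 * (τ : ℂ) + α 1 1) ^ (-w)) := by
  have hdet : 0 < (dilateMatrix d * Matrix.SpecialLinearGroup.mapGL ℝ α).det.val := by
    simpa using det_dilateMatrix_pos d
  rw [slash_apply, σ, if_pos hdet, mul_smul, dilateMatrix_smul, mul_left_comm, ← mul_assoc]
  congr 2
  · simp [dilateMatrix, Matrix.GeneralLinearGroup.mkOfDetNeZero]
  · simp [denom, dilateMatrix, Matrix.GeneralLinearGroup.mkOfDetNeZero, Matrix.mul_apply,
      Fin.sum_univ_two]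

lemma exists_dilate_smul {γ : SL(2, ℤ)} {c : ℤ} (hc : γ 1 0 = d * c) :
    ∃ γ' : SL(2, ℤ), ∀ τ : ℍ, dilate d (γ • τ) = γ' • dilate d τ ∧
      denom γ' (dilate d τ) = γ 1 0 * τ + γ 1 1 := by
  have hdet := Matrix.SpecialLinearGroup.det_coe γ
  rw [Matrix.det_fin_two, hc] at hdet
  obtain ⟨γ', h00, h01, h10, h11⟩ : ∃ γ' : SL(2, ℤ), γ' 0 0 = γ 0 0 ∧ γ' 0 1 = d * γ 0 1 ∧
      γ' 1 0 = c ∧ γ' 1 1 = γ 1 1 :=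
    ⟨⟨!![γ 0 0, d * γ 0 1; c, γ 1 1], by rw [Matrix.det_fin_two_of]; linear_combination hdet⟩,
      rfl, rfl, rfl, rfl⟩
  refine ⟨γ', fun τ ↦ ⟨UpperHalfPlane.ext ?_, ?_⟩⟩
  · rw [coe_dilate, coe_specialLinearGroup_apply, coe_specialLinearGroup_apply, coe_dilate, h00,
      h01, h10, h11, hc]
    simp only [algebraMap_int_eq, eq_intCast, Complex.ofReal_intCast, Int.cast_mul,
      Int.cast_natCast, Complex.ofReal_mul, Complex.ofReal_natCast]
    ring
  · have hdenom : denom γ' (dilate d τ) = γ' 1 0 * (dilate d τ : ℂ) + γ' 1 1 := by simp [denom]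
    rw [hdenom, h10, h11, coe_dilate, hc, Int.cast_mul, Int.cast_natCast]
    ring

end LevelRaising

section CuspForm

lemma mdifferentiable_etaTwist (r : ℕ) {F : ℍ → ℂ} (hF : MDifferentiable 𝓘(ℂ) 𝓘(ℂ) F) :
    MDifferentiable 𝓘(ℂ) 𝓘(ℂ) (etaTwist r F) := by
  rw [mdifferentiable_iff] at hF ⊢
  have h24 {z : ℂ} (hz : 0 < z.im) : 0 < (24 * z).im := by simpa using hz
  have hprod : DifferentiableOn ℂ (fun z ↦ eta (24 * z) ^ r * (F ∘ ofComplex) (24 * z))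
      {z | 0 < z.im} := by
    refine .mul (fun z hz ↦ ?_) (hF.comp (by fun_prop) fun _ ↦ h24)
    exact (((differentiableAt_eta_of_mem_upperHalfPlaneSet (h24 hz)).comp z
      (by fun_prop)).pow r).differentiableWithinAt
  refine hprod.congr fun z hz ↦ ?_
  simp only [Function.comp_apply, etaTwist, ofComplex_apply_of_im_pos hz,
    ofComplex_apply_of_im_pos (h24 hz), dilate]
  rfl

lemma isZeroAtImInfty_of_norm_pow_eq {f g : ℍ → ℂ} {n : ℕ} (hn : n ≠ 0) {C : ℝ}
    (hg : IsZeroAtImInfty g) (h : ∀ τ, ‖f τ‖ ^ n = C * ‖g τ‖) : IsZeroAtImInfty f := by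
  rw [IsZeroAtImInfty, Filter.ZeroAtFilter, tendsto_zero_iff_norm_tendsto_zero] at hg ⊢
  have hroot := (hg.const_mul C).rpow_const (p := (n : ℝ)⁻¹) (Or.inr (by positivity))
  simp_rw [← h, Real.pow_rpow_inv_natCast (norm_nonneg _) hn] at hroot
  simpa [Real.zero_rpow, hn] using hroot

/-- `η²⁴ = Δ`, so the `24`-th power of `η(24τ)^r F(24τ)` is `Δ^r F²⁴` up to dilation. -/
lemma norm_halfSlash_etaTwist_pow {r m : ℕ} (hr : Odd r) (F : ℍ → ℂ) {α : SL(2, ℤ)} {φ : ℍ → ℂ}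
    (hφ : IsShimuraPair α φ) (τ : ℍ) :
    ‖halfSlash (m + (r - 1) / 2) (etaTwist r F) α φ τ‖ ^ 24 =
      (((24 : ℝ) ^ 11) ^ r * ((24 : ℝ) ^ ((m : ℤ) - 1)) ^ 24)⁻¹ *
        ‖(((CuspForm.discriminant : ℍ → ℂ) ∣[(12 : ℤ)]
            (dilateMatrix 24 * Matrix.SpecialLinearGroup.mapGL ℝ α)) ^ r *
          (F ∣[(m : ℤ)] (dilateMatrix 24 * Matrix.SpecialLinearGroup.mapGL ℝ α)) ^ 24) τ‖ := by
  obtain ⟨-, s, hs, hφs⟩ := hφ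
  rw [Pi.mul_apply, Pi.pow_apply, Pi.pow_apply, slash_dilateMatrix_mul, slash_dilateMatrix_mul,
    halfSlash, etaTwist,
    show (CuspForm.discriminant : ℍ → ℂ) (dilate 24 (α • τ)) = eta (24 * ((α • τ : ℍ) : ℂ)) ^ 24
      from rfl]
  have hj : ‖(α 1 0 : ℂ) * τ + α 1 1‖ ≠ 0 := by
    rw [norm_ne_zero_iff, ← ModularGroup.denom_apply]
    exact denom_ne_zero α τ
  have hφj : ‖φ τ‖ ^ (24 * (2 * (m + (r - 1) / 2) + 1)) =
      ‖(α 1 0 : ℂ) * τ + α 1 1‖ ^ (12 * r + 24 * m) := by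
    rw [show 24 * (2 * (m + (r - 1) / 2) + 1) = 2 * (12 * r + 24 * m) by
      obtain ⟨t, rfl⟩ := hr; omega, pow_mul, ← norm_pow, hφs, norm_mul, hs, one_mul]
  simp only [norm_mul, norm_pow, norm_inv, norm_zpow, mul_pow, inv_pow, Nat.cast_ofNat,
    RCLike.norm_ofNat]
  generalize ‖(α 1 0 : ℂ) * τ + α 1 1‖ = j at hj hφj ⊢
  rw [← pow_mul, mul_comm _ 24, hφj, zpow_neg, zpow_neg, zpow_natCast,
    show (12 : ℤ) - 1 = (11 : ℕ) by norm_num, zpow_natCast, show (12 : ℤ) = (12 : ℕ) by norm_num,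
    zpow_natCast, inv_pow, inv_pow]
  field_simp
  ring

lemma isZeroAtImInfty_halfSlash_etaTwist {r m : ℕ} (hr : Odd r) (F : ModularForm 𝒮ℒ (m : ℤ))
    {α : SL(2, ℤ)} {φ : ℍ → ℂ} (hφ : IsShimuraPair α φ) :
    IsZeroAtImInfty (halfSlash (m + (r - 1) / 2) (etaTwist r F) α φ) := by
  have hΔ := (CuspForm.discriminant.zero_at_cusps' (isCusp_dilateMatrix_mul_smul 24 α) _ rfl).pow r
  rw [zero_pow hr.pos.ne'] at hΔ
  have hF := (Filter.boundedFilterSubalgebra ℂ atImInfty).pow_mem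
    (F.bdd_at_cusps' (isCusp_dilateMatrix_mul_smul 24 α) _ rfl) 24
  exact isZeroAtImInfty_of_norm_pow_eq (by norm_num)
    (Filter.ZeroAtFilter.mul_boundedAtFilter hΔ hF) (norm_halfSlash_etaTwist_pow hr F hφ)

lemma chiTwelve_pow_odd {r : ℕ} (hr : Odd r) (x : ZMod 12) : chiTwelve x ^ r = chiTwelve x := by
  have h : ∀ x, chiTwelveInt x = 1 ∨ chiTwelveInt x = -1 ∨ chiTwelveInt x = 0 := by decide
  rw [chiTwelve_apply]
  rcases h x with h | h | h
  · simp [h]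
  · simp [h, hr.neg_one_pow]
  · simp [h, hr.pos.ne']

lemma chiTwelve576_intCast {d : ℤ} (hd : IsCoprime d (576 : ℕ)) :
    chiTwelve576 (d : ZMod 576) = chiTwelve (d : ZMod 12) := by
  rw [chiTwelve576, DirichletCharacter.changeLevel_eq_cast_of_dvd' _ _ hd]

lemma isCoprime_lower_right_of_mem_Gamma0 {N : ℕ} {γ : SL(2, ℤ)}
    (hγ : γ ∈ CongruenceSubgroup.Gamma0 N) : IsCoprime (γ 1 1) N := by
  obtain ⟨c, hc⟩ := (ZMod.intCast_zmod_eq_zero_iff_dvd _ _).mp (CongruenceSubgroup.Gamma0_mem.mp hγ)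
  have hdet := Matrix.SpecialLinearGroup.det_coe γ
  rw [Matrix.det_fin_two, hc] at hdet
  exact ⟨γ 0 0, -(γ 0 1 * c), by linear_combination hdet⟩

lemma modularForm_dilate_smul {m : ℕ} (hm : Even m) (F : ModularForm 𝒮ℒ (m : ℤ)) {d : ℕ} [NeZero d]
    {γ : SL(2, ℤ)} (h4 : γ ∈ CongruenceSubgroup.Gamma0 4) (hγ : γ ∈ CongruenceSubgroup.Gamma0 d)
    (τ : ℍ) : F (dilate d (γ • τ)) = thetaFactor γ τ ^ (2 * m) * F (dilate d τ) := by
  obtain ⟨c, hc⟩ := (ZMod.intCast_zmod_eq_zero_iff_dvd _ _).mp (CongruenceSubgroup.Gamma0_mem.mp hγ)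
  obtain ⟨γ', hγ'⟩ := exists_dilate_smul d hc
  obtain ⟨n, rfl⟩ := hm
  rw [(hγ' τ).1, show 2 * (n + n) = 4 * n by ring, pow_mul, thetaFactor_pow_four h4, ← (hγ' τ).2,
    ← pow_mul, two_mul, ← zpow_natCast]
  exact SlashInvariantForm.slash_action_eqn'' (Γ := 𝒮ℒ) F
    (γ := Matrix.SpecialLinearGroup.mapGL ℝ γ') ⟨γ', rfl⟩ (dilate d τ)

lemma mem_Gamma0_of_dvd {M N : ℕ} (h : M ∣ N) {γ : SL(2, ℤ)}
    (hγ : γ ∈ CongruenceSubgroup.Gamma0 N) : γ ∈ CongruenceSubgroup.Gamma0 M := by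
  rw [CongruenceSubgroup.Gamma0_mem, ZMod.intCast_zmod_eq_zero_iff_dvd] at hγ ⊢
  exact (Int.natCast_dvd_natCast.mpr h).trans hγ

lemma etaTwist_smul {r m : ℕ} (hr : Odd r) (hm : Even m) (F : ModularForm 𝒮ℒ (m : ℤ))
    {γ : SL(2, ℤ)} (hγ : γ ∈ CongruenceSubgroup.Gamma0 576) (τ : ℍ) :
    etaTwist r F (γ • τ) = chiTwelve576 ((γ 1 1 : ℤ) : ZMod 576) *
      thetaFactor γ τ ^ (2 * (m + (r - 1) / 2) + 1) * etaTwist r F τ := by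
  have hk : 2 * (m + (r - 1) / 2) + 1 = r + 2 * m := by
    obtain ⟨t, rfl⟩ := hr
    omega
  rw [etaTwist, etaTwist, eta_smul hγ, mul_pow, mul_pow, chiTwelve_pow_odd hr,
    chiTwelve576_intCast (isCoprime_lower_right_of_mem_Gamma0 hγ), modularForm_dilate_smul hm F
      (mem_Gamma0_of_dvd (by norm_num) hγ) (mem_Gamma0_of_dvd (by norm_num) hγ), hk, pow_add]
  ring

theorem isCuspForm_etaTwist {r m : ℕ} (hr : Odd r) (hm : Even m) (F : ModularForm 𝒮ℒ (m : ℤ)) :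
    IsCuspForm (m + (r - 1) / 2) 576 chiTwelve576 (etaTwist r F) where
  holo := mdifferentiable_etaTwist r F.holo'
  transform _ hγ τ := etaTwist_smul hr hm F hγ τ
  zero_at_cusps _ _ hφ := isZeroAtImInfty_halfSlash_etaTwist hr F hφ

lemma exists_dilate_eq (d : ℕ) [NeZero d] (z : ℍ) : ∃ τ, dilate d τ = z := by
  have hd : (0 : ℝ) < d := Nat.cast_pos.mpr (NeZero.pos d)
  refine ⟨⟨z / d, by rw [Complex.div_natCast_im]; exact div_pos z.im_pos hd⟩, ?_⟩
  ext
  rw [coe_dilate, coe_mk, mul_div_cancel₀ _ (NeZero.ne (d : ℂ))]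

lemma etaTwist_ne_zero (r : ℕ) {F : ℍ → ℂ} (hF : F ≠ 0) : etaTwist r F ≠ 0 := by
  obtain ⟨z, hz⟩ := Function.ne_iff.mp hF
  obtain ⟨τ, rfl⟩ := exists_dilate_eq 24 z
  exact Function.ne_iff.mpr
    ⟨τ, mul_ne_zero (pow_ne_zero r (ModularForm.eta_ne_zero (dilate 24 τ).im_pos)) hz⟩

end CuspForm

section LegendreGauss

variable {ℓ : ℕ} [Fact ℓ.Prime]

variable (ℓ) in
/-- The Legendre symbol modulo `ℓ`, as a complex-valued character. -/
def legendreChar : MulChar (ZMod ℓ) ℂ :=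
  (quadraticChar (ZMod ℓ)).ringHomComp (Int.castRingHom ℂ)

variable (ℓ) in
/-- The Gauss sum `∑ (b / ℓ) exp(2πi b / ℓ)` of the Legendre symbol modulo `ℓ`. -/
def legendreGauss : ℂ := gaussSum (legendreChar ℓ) ZMod.stdAddChar

lemma legendreChar_intCast (a : ℤ) : legendreChar ℓ (a : ZMod ℓ) = (legendreSym ℓ a : ℂ) := rfl

lemma isQuadratic_legendreChar : (legendreChar ℓ).IsQuadratic :=
  (quadraticChar_isQuadratic _).comp _

lemma legendreChar_sq {x : ZMod ℓ} (hx : x ≠ 0) : legendreChar ℓ x ^ 2 = 1 := by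
  have h : ((quadraticChar (ZMod ℓ) x : ℤ) : ℂ) ^ 2 = 1 := mod_cast quadraticChar_sq_one hx
  exact h

lemma legendreChar_neg_one_sq : legendreChar ℓ (-1) ^ 2 = 1 :=
  legendreChar_sq (neg_ne_zero.mpr one_ne_zero)

lemma legendreChar_pow_odd {r : ℕ} (hr : Odd r) {x : ZMod ℓ} (hx : x ≠ 0) :
    legendreChar ℓ x ^ r = legendreChar ℓ x := by
  obtain ⟨t, rfl⟩ := hr
  rw [pow_succ, pow_mul, legendreChar_sq hx, one_pow, one_mul]

lemma ringChar_zmod_ne_two (hℓ : ℓ ≠ 2) : ringChar (ZMod ℓ) ≠ 2 := by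
  rwa [ZMod.ringChar_zmod_n]

lemma legendreChar_ne_one (hℓ : ℓ ≠ 2) : legendreChar ℓ ≠ 1 :=
  (MulChar.ringHomComp_ne_one_iff (RingHom.injective_int _)).mpr
    (quadraticChar_ne_one (ringChar_zmod_ne_two hℓ))

lemma legendreGauss_sq (hℓ : ℓ ≠ 2) : legendreGauss ℓ ^ 2 = legendreChar ℓ (-1) * ℓ := by
  rw [legendreGauss, gaussSum_sq (χ := legendreChar ℓ) (legendreChar_ne_one hℓ)
    isQuadratic_legendreChar (ZMod.isPrimitive_stdAddChar ℓ), ZMod.card]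

lemma sum_legendreChar_mul_stdAddChar (hℓ : ℓ ≠ 2) (n : ZMod ℓ) :
    ∑ b : ZMod ℓ, legendreChar ℓ b * ZMod.stdAddChar (n * b) =
      legendreChar ℓ n * legendreGauss ℓ := by
  obtain rfl | hn := eq_or_ne n 0
  · simpa [MulChar.map_zero] using MulChar.sum_eq_zero_of_ne_one (legendreChar_ne_one hℓ)
  · have h := gaussSum_mulShift_eq (legendreChar ℓ) ZMod.stdAddChar (Units.mk0 n hn)
    rwa [isQuadratic_legendreChar.inv] at h

lemma card_filter_sq_eq (hℓ : ℓ ≠ 2) (y : ZMod ℓ) :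
    (Finset.card {x : ZMod ℓ | x ^ 2 = y} : ℂ) = legendreChar ℓ y + 1 := by
  have h := quadraticChar_card_sqrts (ringChar_zmod_ne_two hℓ) y
  rw [Set.toFinset_ofPred] at h
  have h' : ((Finset.card {x : ZMod ℓ | x ^ 2 = y} : ℤ) : ℂ) =
    ((quadraticChar (ZMod ℓ) y + 1 : ℤ) : ℂ) := congrArg _ h
  push_cast at h'
  exact h'

lemma sum_comp_sq (hℓ : ℓ ≠ 2) (f : ZMod ℓ → ℂ) :
    ∑ x, f (x ^ 2) = ∑ y, (legendreChar ℓ y + 1) * f y := by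
  rw [← Finset.sum_fiberwise (s := Finset.univ) (g := fun x : ZMod ℓ ↦ x ^ 2)]
  refine Finset.sum_congr rfl fun y _ ↦ ?_
  rw [← card_filter_sq_eq hℓ, ← nsmul_eq_mul]
  exact Finset.sum_eq_card_nsmul fun x hx ↦ by rw [(Finset.mem_filter.mp hx).2]

lemma quadGauss_prime (hℓ : ℓ ≠ 2) {b : ZMod ℓ} (hb : b ≠ 0) :
    quadGauss b = legendreChar ℓ b * legendreGauss ℓ := by
  have hsum : ∑ y : ZMod ℓ, (ZMod.stdAddChar (b * y) : ℂ) = 0 := by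
    simp_rw [mul_comm b]
    rw [AddChar.sum_mulShift _ (ZMod.isPrimitive_stdAddChar ℓ), if_neg hb, Nat.cast_zero]
  rw [quadGauss, sum_comp_sq hℓ fun y ↦ ZMod.stdAddChar (b * y)]
  simp_rw [add_mul, one_mul]
  rw [Finset.sum_add_distrib, sum_legendreChar_mul_stdAddChar hℓ, hsum, add_zero]

/- Averaging the Gauss sum over the shifts `x ↦ x + c t` kills the `x` with `c x ≠ 0`. -/
lemma quadGauss_eq_card {d : ℕ} [NeZero d] {b c : ZMod d} (hb : IsUnit (2 * b)) (hc : c ^ 2 = 0)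
    (hsq : ∀ x, c * x = 0 → x ^ 2 = 0) :
    quadGauss b = Finset.card {x : ZMod d | c * x = 0} := by
  have hshift (t : ZMod d) :
      ∑ x : ZMod d, (ZMod.stdAddChar (b * (x + c * t) ^ 2) : ℂ) = quadGauss b :=
    Equiv.sum_comp (Equiv.addRight (c * t)) fun x ↦ (ZMod.stdAddChar (b * x ^ 2) : ℂ)
  have hexpand (x t : ZMod d) : (ZMod.stdAddChar (b * (x + c * t) ^ 2) : ℂ) =
      ZMod.stdAddChar (b * x ^ 2) * ZMod.stdAddChar (t * (2 * b * (c * x))) := by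
    rw [← AddChar.map_add_eq_mul]
    congr 1
    linear_combination b * t ^ 2 * hc
  have hterm (x : ZMod d) : ∑ t : ZMod d, (ZMod.stdAddChar (b * (x + c * t) ^ 2) : ℂ) =
      if c * x = 0 then (d : ℂ) else 0 := by
    simp_rw [hexpand, ← Finset.mul_sum, AddChar.sum_mulShift _ (ZMod.isPrimitive_stdAddChar d),
      hb.mul_right_eq_zero, ZMod.card]
    split_ifs with hx
    · rw [hsq x hx, mul_zero, AddChar.map_zero_eq_one, one_mul]
    · simp
  refine mul_left_cancel₀ (NeZero.ne (d : ℂ)) ?_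
  calc (d : ℂ) * quadGauss b
      = ∑ t : ZMod d, ∑ x : ZMod d, (ZMod.stdAddChar (b * (x + c * t) ^ 2) : ℂ) := by
        simp_rw [hshift, Finset.sum_const, Finset.card_univ, ZMod.card, nsmul_eq_mul]
    _ = ∑ x : ZMod d, if c * x = 0 then (d : ℂ) else 0 := by
        rw [Finset.sum_comm, Finset.sum_congr rfl fun x _ ↦ hterm x]
    _ = d * Finset.card {x : ZMod d | c * x = 0} := by
        rw [← Finset.sum_filter, Finset.sum_const, nsmul_eq_mul, mul_comm]

lemma sq_eq_zero_of_prime_mul_eq_zero {x : ZMod (ℓ ^ 2)} (hx : (ℓ : ZMod (ℓ ^ 2)) * x = 0) :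
    x ^ 2 = 0 := by
  obtain ⟨y, rfl⟩ := ZMod.natCast_zmod_surjective x
  rw [← Nat.cast_mul, ZMod.natCast_eq_zero_iff, pow_two] at hx
  rw [← Nat.cast_pow, ZMod.natCast_eq_zero_iff]
  exact pow_dvd_pow_of_dvd (Nat.dvd_of_mul_dvd_mul_left (Fact.out : ℓ.Prime).pos hx) 2

lemma quadGauss_prime_sq (hℓ : ℓ ≠ 2) {b : ZMod (ℓ ^ 2)} (hb : IsUnit b) :
    quadGauss b = ℓ := by
  have hodd : Odd (ℓ ^ 2) := ((Fact.out : ℓ.Prime).odd_of_ne_two hℓ).pow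
  have h2 : IsUnit (2 : ZMod (ℓ ^ 2)) := by
    simpa using (ZMod.isUnit_iff_coprime 2 (ℓ ^ 2)).mpr (Nat.coprime_two_left.mpr hodd)
  have hℓ2 : (ℓ : ZMod (ℓ ^ 2)) ^ 2 = 0 := by rw [← Nat.cast_pow, ZMod.natCast_self]
  have hcard := quadGauss_eq_card (h2.mul hb) hℓ2 fun x ↦ sq_eq_zero_of_prime_mul_eq_zero
  have hpow := quadGauss_pow_four hodd hb
  rw [hcard] at hpow ⊢
  norm_cast at hpow ⊢
  rw [← pow_mul] at hpow
  exact Nat.pow_left_injective (n := 4) (by norm_num) hpow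

end LegendreGauss

section Expansion

lemma qParam_natCast_mul (h : ℝ) (n : ℕ) (z : ℂ) :
    qParam h (n * z) = qParam h z ^ n := by
  rw [qParam, qParam, ← Complex.exp_nat_mul]
  ring_nf

lemma qParam_add (h : ℝ) (z w : ℂ) : qParam h (z + w) =
    qParam h z * qParam h w := by
  rw [qParam, qParam, qParam,
    ← Complex.exp_add]
  ring_nf

lemma qParam_one_eq (z : ℂ) :
    qParam 1 z = qParam 24 (24 * z) := by
  rw [qParam, qParam]
  push_cast
  ring_nf

lemma im_add_ofReal_div_pos {D : ℕ} (hD : D ≠ 0) {z : ℂ} (hz : 0 < z.im) (x : ℝ) :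
    0 < ((z + x) / D).im := by
  rw [Complex.div_natCast_im, Complex.add_im, Complex.ofReal_im, add_zero]
  positivity

lemma im_translate_pos {D : ℕ} (hD : D ≠ 0) {z : ℂ} (hz : 0 < z.im) (b : ℤ) :
    0 < ((z + 24 * b) / D).im := by
  simpa using im_add_ofReal_div_pos hD hz (24 * b)

lemma natCast_mul_im_pos {D : ℕ} (hD : D ≠ 0) {z : ℂ} (hz : 0 < z.im) : 0 < (D * z).im := by
  simpa using mul_pos (Nat.cast_pos.mpr hD.bot_lt) hz

lemma hasSum_comp_mul_left_iff {D : ℕ} [NeZero D] {g : ℕ → ℂ} (hg : ∀ n, ¬D ∣ n → g n = 0)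
    {s : ℂ} : HasSum (fun n ↦ g (D * n)) s ↔ HasSum g s :=
  (mul_right_injective₀ (NeZero.ne D)).hasSum_iff fun n hn ↦
    hg n fun ⟨k, hk⟩ ↦ hn ⟨k, hk.symm⟩

/-- `f(z) = ∑ a(n) q^(n / 24)` on the upper half plane. -/
def HasExpansion (f : ℂ → ℂ) (a : ℕ → ℂ) : Prop :=
  ∀ z : ℂ, 0 < z.im → HasSum (fun n ↦ a n * qParam 24 z ^ n) (f z)

/-- The value of `f` at `(z + 24 b) / D`, which for `f` of period `24` only depends on the residue
class `b` modulo `D`. -/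
def translate (f : ℂ → ℂ) (D : ℕ) (z : ℂ) (b : ZMod D) : ℂ := f ((z + 24 * b.val) / D)

namespace HasExpansion

variable {f : ℂ → ℂ} {a : ℕ → ℂ} {D : ℕ} [NeZero D] {z : ℂ}

lemma add_intCast (h : HasExpansion f a) (j : ℤ) (hz : 0 < z.im) : f (z + 24 * j) = f z := by
  have hq : qParam 24 (z + 24 * j) = qParam 24 z := by
    have hj : qParam 24 (24 * j) = 1 :=
      Complex.exp_eq_one_iff.mpr ⟨j, by push_cast; ring⟩
    rw [qParam_add, hj, mul_one]
  refine ((h (z + 24 * j) (by simpa using hz)).congr_fun fun n ↦ ?_).unique (h z hz)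
  rw [hq]

lemma translate_intCast (h : HasExpansion f a) (b : ℤ) (hz : 0 < z.im) :
    translate f D z (b : ZMod D) = f ((z + 24 * b) / D) := by
  have hD : (D : ℂ) ≠ 0 := NeZero.ne _
  obtain ⟨j, hj⟩ : (D : ℤ) ∣ b - ((b : ZMod D).val : ℤ) := by
    rw [← ZMod.intCast_zmod_eq_zero_iff_dvd]; simp
  have hb : (b : ℂ) = ((b : ZMod D).val : ℂ) + D * j := by
    exact_mod_cast (by linear_combination hj : b = ((b : ZMod D).val : ℤ) + D * j)
  have hz' := im_translate_pos (NeZero.ne D) hz ((b : ZMod D).val : ℤ)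
  rw [Int.cast_natCast] at hz'
  rw [translate, ← h.add_intCast j hz', hb]
  congr 1
  field_simp
  ring

lemma hasSum_translate (h : HasExpansion f a) (ψ : ZMod D → ℂ) (hz : 0 < z.im) :
    HasSum (fun n : ℕ ↦ a n * (∑ b : ZMod D, ψ b * ZMod.stdAddChar ((n : ZMod D) * b)) *
      qParam 24 (z / D) ^ n) (∑ b : ZMod D, ψ b * translate f D z b) := by
  have hq (b : ZMod D) (n : ℕ) : qParam 24 ((z + 24 * b.val) / D) ^ n =
      ZMod.stdAddChar ((n : ZMod D) * b) * qParam 24 (z / D) ^ n := by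
    rw [add_div, qParam_add, mul_pow, mul_comm, ← qParam_natCast_mul, mul_comm (n : ZMod D),
      ← Int.cast_natCast (R := ZMod D) n, stdAddChar_mul_intCast, qParam]
    push_cast
    ring_nf
  have him (b : ZMod D) : 0 < ((z + 24 * b.val) / D).im := by
    simpa using im_translate_pos (NeZero.ne D) hz b.val
  refine (hasSum_sum fun b _ ↦ (h _ (him b)).mul_left (ψ b)).congr_fun fun n ↦ ?_
  rw [Finset.mul_sum, Finset.sum_mul]
  refine Finset.sum_congr rfl fun b _ ↦ ?_
  rw [hq]
  ring

lemma hasSum_coeff_mul (h : HasExpansion f a) (hz : 0 < z.im) :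
    HasSum (fun n : ℕ ↦ a (D * n) * qParam 24 z ^ n)
      ((D : ℂ)⁻¹ * ∑ b : ZMod D, translate f D z b) := by
  have hD : (D : ℂ) ≠ 0 := NeZero.ne _
  have hsum (n : ℕ) : ∑ b : ZMod D, (ZMod.stdAddChar ((n : ZMod D) * b) : ℂ) =
      if D ∣ n then (D : ℂ) else 0 := by
    simp_rw [mul_comm (n : ZMod D)]
    rw [AddChar.sum_mulShift _ (ZMod.isPrimitive_stdAddChar D), ZMod.card]
    simp only [ZMod.natCast_eq_zero_iff, Nat.cast_ite, Nat.cast_zero]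
  have hsum' := (h.hasSum_translate (D := D) (fun _ ↦ 1) hz).mul_left (D : ℂ)⁻¹
  simp only [one_mul, hsum] at hsum'
  rw [← hasSum_comp_mul_left_iff (D := D) fun n hn ↦ by simp [hn]] at hsum'
  refine hsum'.congr_fun fun n ↦ ?_
  rw [if_pos (dvd_mul_right D n), pow_mul, ← qParam_natCast_mul 24 D, mul_div_cancel₀ _ hD]
  field_simp

lemma hasSum_coeff_div (h : HasExpansion f a) (hz : 0 < z.im) :
    HasSum (fun n : ℕ ↦ (if D ∣ n then a (n / D) else 0) * qParam 24 z ^ n)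
      (f (D * z)) := by
  rw [← hasSum_comp_mul_left_iff (D := D) fun n hn ↦ by rw [if_neg hn, zero_mul]]
  refine (h (D * z) (natCast_mul_im_pos (NeZero.ne D) hz)).congr_fun fun n ↦ ?_
  rw [if_pos (dvd_mul_right D n), Nat.mul_div_cancel_left n (NeZero.pos D), qParam_natCast_mul,
    pow_mul]

lemma hasSum_coeff_mul_legendreChar (h : HasExpansion f a) {ℓ : ℕ} [Fact ℓ.Prime] (hℓ : ℓ ≠ 2)
    (hz : 0 < z.im) :
    HasSum (fun n : ℕ ↦ a n * (legendreChar ℓ n * legendreGauss ℓ) *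
      qParam 24 z ^ n)
      (∑ b : ZMod ℓ, legendreChar ℓ b * translate f ℓ (ℓ * z) b) := by
  have hsum' := h.hasSum_translate (D := ℓ) (legendreChar ℓ) (natCast_mul_im_pos (NeZero.ne ℓ) hz)
  simp_rw [sum_legendreChar_mul_stdAddChar hℓ, mul_div_cancel_left₀ z (NeZero.ne (ℓ : ℂ))] at hsum'
  exact hsum'

end HasExpansion

end Expansion

section UnitSums

variable {M A : Type*} [AddCommMonoid A]

lemma sum_units_add_sum_not_isUnit [Monoid M] [Fintype M] [Fintype Mˣ]
    [DecidablePred (IsUnit : M → Prop)] (g : M → A) :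
    ∑ u : Mˣ, g u + ∑ x with ¬IsUnit x, g x = ∑ x, g x := by
  rw [← Finset.sum_filter_add_sum_filter_not Finset.univ (fun x : M ↦ IsUnit x)]
  congr 1
  refine Finset.sum_bij (fun u _ ↦ (u : M)) (fun u _ ↦ by simp) (fun u _ v _ h ↦ Units.ext h)
    (fun x hx ↦ ?_) fun _ _ ↦ rfl
  obtain ⟨u, rfl⟩ := (Finset.mem_filter.mp hx).2
  exact ⟨u, Finset.mem_univ _, rfl⟩

lemma sum_eq_zero_add_sum_units [GroupWithZero M] [Fintype M] [Fintype Mˣ] (g : M → A) :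
    ∑ x, g x = g 0 + ∑ u : Mˣ, g u := by
  classical
  rw [← sum_units_add_sum_not_isUnit, add_comm]
  congr 1
  simp [isUnit_iff_ne_zero, Finset.sum_filter]

variable {ℓ : ℕ} [Fact ℓ.Prime]

lemma isUnit_natCast_zmod_prime_sq (n : ℕ) : IsUnit (n : ZMod (ℓ ^ 2)) ↔ ¬ℓ ∣ n := by
  rw [ZMod.isUnit_iff_coprime, Nat.coprime_pow_right_iff two_pos, Nat.coprime_comm,
    (Fact.out : ℓ.Prime).coprime_iff_not_dvd]

lemma sum_zmod_prime_sq (g : ZMod (ℓ ^ 2) → A) :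
    ∑ x, g x = ∑ u : (ZMod (ℓ ^ 2))ˣ, g u + ∑ c : ZMod ℓ, g ((ℓ * c.val : ℕ) : ZMod (ℓ ^ 2)) := by
  classical
  have hpos : 0 < ℓ := NeZero.pos ℓ
  have hlt (c : ZMod ℓ) : ℓ * c.val < ℓ ^ 2 := by
    rw [pow_two]
    exact Nat.mul_lt_mul_of_pos_left c.val_lt hpos
  rw [← sum_units_add_sum_not_isUnit]
  congr 1
  symm
  refine Finset.sum_bij (fun c _ ↦ ((ℓ * c.val : ℕ) : ZMod (ℓ ^ 2))) (fun c _ ↦ ?_)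
    (fun c _ c' _ h ↦ ?_) (fun x hx ↦ ?_) fun _ _ ↦ rfl
  · simp only [Finset.mem_filter, Finset.mem_univ, isUnit_natCast_zmod_prime_sq, dvd_mul_right,
      not_true, not_false_eq_true, and_self]
  · have hval := congrArg ZMod.val h
    rw [ZMod.val_natCast_of_lt (hlt c), ZMod.val_natCast_of_lt (hlt c')] at hval
    exact ZMod.val_injective ℓ (Nat.eq_of_mul_eq_mul_left hpos hval)
  · rw [Finset.mem_filter, ← ZMod.natCast_zmod_val x, isUnit_natCast_zmod_prime_sq, not_not] at hx
    obtain ⟨y, hy⟩ := hx.2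
    have hyℓ : y < ℓ := by
      have := x.val_lt
      rw [hy, pow_two] at this
      exact Nat.lt_of_mul_lt_mul_left this
    refine ⟨(y : ZMod ℓ), Finset.mem_univ _, ?_⟩
    rw [ZMod.val_natCast_of_lt hyℓ, ← hy, ZMod.natCast_zmod_val]

/-- The sum of the translates `f((z + 24 u) / D)` over the units `u` modulo `D`, weighted by
`ψ`. -/
def unitSum (f : ℂ → ℂ) (D : ℕ) [NeZero D] (ψ : ZMod D → ℂ) (z : ℂ) : ℂ :=
  ∑ u : (ZMod D)ˣ, ψ u * translate f D z u

lemma unitSum_one (f : ℂ → ℂ) (D : ℕ) [NeZero D] (z : ℂ) :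
    unitSum f D 1 z = ∑ u : (ZMod D)ˣ, translate f D z u := by
  simp only [unitSum, Pi.one_apply, one_mul]

lemma sum_legendreChar_mul_translate (f : ℂ → ℂ) (z : ℂ) :
    ∑ b : ZMod ℓ, legendreChar ℓ b * translate f ℓ z b = unitSum f ℓ (legendreChar ℓ) z := by
  rw [sum_eq_zero_add_sum_units, MulChar.map_zero, zero_mul, zero_add, unitSum]

lemma HasExpansion.sum_translate_prime_sq {f : ℂ → ℂ} {a : ℕ → ℂ} (h : HasExpansion f a) {z : ℂ}
    (hz : 0 < z.im) :
    ∑ b : ZMod (ℓ ^ 2), translate f (ℓ ^ 2) z b =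
      f (z / ℓ ^ 2) + unitSum f ℓ 1 (z / ℓ) + unitSum f (ℓ ^ 2) 1 z := by
  have hℓ0 : (ℓ : ℂ) ≠ 0 := NeZero.ne _
  have hmultiple (c : ZMod ℓ) : translate f (ℓ ^ 2) z ((ℓ * c.val : ℕ) : ZMod (ℓ ^ 2)) =
      translate f ℓ (z / ℓ) c := by
    rw [← Int.cast_natCast, h.translate_intCast _ hz, translate]
    congr 1
    push_cast
    field_simp
  have hzero : translate f ℓ (z / ℓ) 0 = f (z / ℓ ^ 2) := by
    rw [translate, ZMod.val_zero, Nat.cast_zero, mul_zero, add_zero, div_div, pow_two]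
  simp_rw [sum_zmod_prime_sq, hmultiple]
  rw [sum_eq_zero_add_sum_units (M := ZMod ℓ), hzero, unitSum_one, unitSum_one]
  ring

end UnitSums

section Inversion

variable {r m : ℕ}

/-- The function `η(z)^r F(z)` on the upper half plane, as a function of a complex variable. -/
def etaForm (r : ℕ) (F : ℍ → ℂ) (z : ℂ) : ℂ := eta z ^ r * F (ofComplex z)

/-- The automorphy factor `(-iσ)^(r/2) σ^m` of `η^r F` under `σ ↦ -1 / σ`. -/
def autFactor (r m : ℕ) (σ : ℂ) : ℂ := ((-Complex.I * σ) ^ (1 / 2 : ℂ)) ^ r * σ ^ m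

/-- The fourth root of unity `χ₁₂(D) D^(-1/2) ∑ exp(2πi b x² / D)`. -/
def gaussPhase {D : ℕ} [NeZero D] (b : ZMod D) : ℂ := chiTwelve D * (quadGauss b / √D)

lemma autFactor_ofReal_mul {c : ℝ} (hc : 0 < c) (σ : ℂ) :
    autFactor r m (c * σ) = √c ^ (r + 2 * m) * autFactor r m σ := by
  rw [autFactor, autFactor, mul_left_comm, ofReal_mul_cpow_half hc, mul_pow, mul_pow, pow_add,
    pow_mul, ← Complex.ofReal_pow _ 2, Real.sq_sqrt hc.le]
  ring

lemma exists_smul_eq_sub_one_div {D : ℕ} [NeZero D] {b b' : ℤ} (hb : (D : ℤ) ∣ 576 * b * b' + 1)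
    {σ : ℂ} (hσ : 0 < σ.im) :
    ∃ (γ : SL(2, ℤ)) (w : ℍ), (w : ℂ) = (σ + 24 * b') / D ∧
      ((γ • w : ℍ) : ℂ) = (24 * b - 1 / σ) / D ∧ denom γ w = σ := by
  obtain ⟨y, hy⟩ := hb
  have hD : (D : ℂ) ≠ 0 := NeZero.ne _
  have hσ0 : σ ≠ 0 := by rintro rfl; simp at hσ
  have hy' : (576 : ℂ) * b * b' + 1 = D * y := by exact_mod_cast hy
  have hden : (D : ℂ) * ((σ + 24 * b') / D) + -(24 * b') = σ := by field_simp; ring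
  obtain ⟨γ, h00, h01, h10, h11⟩ : ∃ γ : SL(2, ℤ),
      γ 0 0 = 24 * b ∧ γ 0 1 = -y ∧ γ 1 0 = D ∧ γ 1 1 = -(24 * b') :=
    ⟨⟨!![24 * b, -y; D, -(24 * b')], by rw [Matrix.det_fin_two_of]; linear_combination -hy⟩,
      rfl, rfl, rfl, rfl⟩
  refine ⟨γ, ⟨(σ + 24 * b') / D, im_translate_pos (NeZero.ne D) hσ b'⟩, rfl, ?_, ?_⟩
  · rw [coe_specialLinearGroup_apply, h00, h01, h10, h11]
    simp only [algebraMap_int_eq, eq_intCast, Complex.ofReal_intCast]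
    push_cast
    rw [hden]
    field_simp
    linear_combination hy'
  · simpa [denom, h10, h11] using hden

lemma modularForm_inversion (F : ModularForm 𝒮ℒ (m : ℤ)) {D : ℕ} [NeZero D] {b b' : ℤ}
    (hb : (D : ℤ) ∣ 576 * b * b' + 1) {σ : ℂ} (hσ : 0 < σ.im) :
    F (ofComplex ((24 * b - 1 / σ) / D)) = σ ^ m * F (ofComplex ((σ + 24 * b') / D)) := by
  obtain ⟨γ, w, hw, hγw, hden⟩ := exists_smul_eq_sub_one_div hb hσ
  have hF := SlashInvariantForm.slash_action_eqn'' (Γ := 𝒮ℒ) F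
    (γ := Matrix.SpecialLinearGroup.mapGL ℝ γ) ⟨γ, rfl⟩ w
  rw [← hγw, ← hw, ofComplex_apply, ofComplex_apply, ← zpow_natCast, ← hden]
  exact hF

/-- The inversion formula satisfied by `η^r F`, at all rational points with denominator prime to
`12`. -/
def HasEtaInversion (r m : ℕ) (f : ℂ → ℂ) : Prop :=
  ∀ (D : ℕ) [NeZero D], Nat.Coprime 12 D → ∀ b b' : ℤ, (D : ℤ) ∣ 576 * b * b' + 1 →
    ∀ σ : ℂ, 0 < σ.im → f ((24 * b - 1 / σ) / D) =
      gaussPhase (b : ZMod D) ^ r * autFactor r m σ * f ((σ + 24 * b') / D)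

lemma hasEtaInversion_etaForm (r : ℕ) (F : ModularForm 𝒮ℒ (m : ℤ)) :
    HasEtaInversion r m (etaForm r F) := by
  intro D _ hD b b' hb σ hσ
  rw [etaForm, modularForm_inversion F hb hσ, eta_inversion hD hb hσ, gaussPhase, autFactor,
    etaForm]
  ring

variable {D : ℕ}

lemma isUnit_576 (hD : Nat.Coprime 12 D) : IsUnit (576 : ZMod D) := by
  have h24 : IsUnit ((24 : ℕ) : ZMod D) :=
    (ZMod.isUnit_iff_coprime 24 D).mpr
      (Nat.Coprime.mul_left hD (hD.coprime_dvd_left (by norm_num : 2 ∣ 12)))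
  have h : ((24 : ℕ) : ZMod D) * ((24 : ℕ) : ZMod D) = 576 := by norm_num
  exact h ▸ h24.mul h24

/-- The involution `b ↦ -1 / (576 b)` of the units modulo `D`. -/
def unitInv (hD : Nat.Coprime 12 D) : (ZMod D)ˣ ≃ (ZMod D)ˣ :=
  (Equiv.inv _).trans (Equiv.mulLeft (-(isUnit_576 hD).unit⁻¹))

lemma mul_unitInv (hD : Nat.Coprime 12 D) (u : (ZMod D)ˣ) :
    (576 : ZMod D) * u * (unitInv hD u : (ZMod D)ˣ) = -1 := by
  have h : (isUnit_576 hD).unit * u * unitInv hD u = -1 := by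
    simp only [unitInv, Equiv.trans_apply, Equiv.inv_apply, Equiv.coe_mulLeft, neg_mul, mul_neg]
    rw [mul_mul_mul_comm, mul_inv_cancel, mul_inv_cancel, one_mul]
  simpa using congrArg Units.val h

namespace HasEtaInversion

variable {f : ℂ → ℂ} [NeZero D] {σ : ℂ}

lemma apply_neg_one_div (h : HasEtaInversion r m f) (hσ : 0 < σ.im) :
    f (-1 / σ) = autFactor r m σ * f σ := by
  simpa [gaussPhase, quadGauss_one, neg_div] using h 1 (by norm_num) 0 0 (by norm_num) σ hσ

lemma translate_neg_one_div (h : HasEtaInversion r m f) (hD : Nat.Coprime 12 D) (u : (ZMod D)ˣ)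
    (hσ : 0 < σ.im) : translate f D (-1 / σ) u =
      gaussPhase (u : ZMod D) ^ r * autFactor r m σ * translate f D σ (unitInv hD u) := by
  have hdvd : (D : ℤ) ∣ 576 * ((u : ZMod D).val : ℤ) * ((unitInv hD u : ZMod D).val : ℤ) + 1 := by
    rw [← ZMod.intCast_zmod_eq_zero_iff_dvd]
    push_cast
    rw [ZMod.natCast_zmod_val, ZMod.natCast_zmod_val, mul_unitInv, neg_add_cancel]
  have hu := h D hD _ _ hdvd σ hσ
  simp only [Int.cast_natCast, ZMod.natCast_zmod_val] at hu
  rw [translate, translate, ← hu]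
  ring_nf

lemma unitSum_neg_one_div (h : HasEtaInversion r m f) (hD : Nat.Coprime 12 D) {ψ ψ' : ZMod D → ℂ}
    {κ : ℂ} (hψ : ∀ u : (ZMod D)ˣ, ψ u * gaussPhase (u : ZMod D) ^ r = κ * ψ' (unitInv hD u))
    (hσ : 0 < σ.im) :
    unitSum f D ψ (-1 / σ) = κ * autFactor r m σ * unitSum f D ψ' σ := by
  rw [unitSum, unitSum, Finset.mul_sum, ← Equiv.sum_comp (unitInv hD)
    fun u : (ZMod D)ˣ ↦ κ * autFactor r m σ * (ψ' u * translate f D σ u)]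
  refine Finset.sum_congr rfl fun u _ ↦ ?_
  rw [h.translate_neg_one_div hD u hσ]
  linear_combination autFactor r m σ * translate f D σ (unitInv hD u) * hψ u

end HasEtaInversion

end Inversion

section HeckeInversion

variable {r m ℓ : ℕ} [Fact ℓ.Prime]

lemma coprime_twelve_prime (hℓ : 3 < ℓ) : Nat.Coprime 12 ℓ :=
  Nat.Coprime.mul_left (m := 4) (n := 3)
    (Nat.Coprime.pow_left 2 ((Nat.coprime_primes Nat.prime_two Fact.out).mpr (by omega)))
    ((Nat.coprime_primes Nat.prime_three Fact.out).mpr (by omega))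

lemma chiTwelve_sq_of_coprime {n : ℕ} (hn : Nat.Coprime 12 n) :
    chiTwelve (n : ZMod 12) ^ 2 = 1 := by
  have h : ∀ x, IsUnit x → chiTwelveInt x ^ 2 = 1 := by decide
  rw [chiTwelve_apply]
  exact_mod_cast h n ((ZMod.isUnit_iff_coprime n 12).mpr hn.symm)

lemma gaussPhase_prime_sq (hℓ : 3 < ℓ) (u : (ZMod (ℓ ^ 2))ˣ) :
    gaussPhase (u : ZMod (ℓ ^ 2)) = 1 := by
  rw [gaussPhase, quadGauss_prime_sq (by omega) u.isUnit, Nat.cast_pow, map_pow,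
    chiTwelve_sq_of_coprime (coprime_twelve_prime hℓ), Nat.cast_pow,
    Real.sqrt_sq (Nat.cast_nonneg _), Complex.ofReal_natCast, div_self (NeZero.ne _), one_mul]

variable (ℓ) in
/-- The fourth root of unity `χ₁₂(ℓ) ℓ^(-1/2) ∑ (b / ℓ) exp(2πi b / ℓ)`. -/
def primePhase : ℂ := chiTwelve ℓ * (legendreGauss ℓ / √ℓ)

lemma gaussPhase_prime (hℓ : 3 < ℓ) (u : (ZMod ℓ)ˣ) :
    gaussPhase (u : ZMod ℓ) = legendreChar ℓ u * primePhase ℓ := by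
  rw [gaussPhase, quadGauss_prime (by omega) u.ne_zero, primePhase]
  ring

lemma primePhase_sq (hℓ : 3 < ℓ) : primePhase ℓ ^ 2 = legendreChar ℓ (-1) := by
  rw [primePhase, mul_pow, div_pow, chiTwelve_sq_of_coprime (coprime_twelve_prime hℓ),
    legendreGauss_sq (by omega), ← Complex.ofReal_pow, Real.sq_sqrt (Nat.cast_nonneg _),
    Complex.ofReal_natCast, one_mul, mul_div_cancel_right₀ _ (NeZero.ne _)]

lemma primePhase_pow_mul_self (hr : Odd r) (hℓ : 3 < ℓ) :
    primePhase ℓ ^ r * primePhase ℓ ^ r = legendreChar ℓ (-1) := by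
  rw [← pow_two, pow_right_comm, primePhase_sq hℓ,
    legendreChar_pow_odd hr (neg_ne_zero.mpr one_ne_zero)]

lemma legendreChar_unitInv (hℓ : 3 < ℓ) (u : (ZMod ℓ)ˣ) :
    legendreChar ℓ (unitInv (coprime_twelve_prime hℓ) u : (ZMod ℓ)ˣ) =
      legendreChar ℓ (-1) * legendreChar ℓ u := by
  have h576 : legendreChar ℓ 576 = 1 := by
    have h24 : (24 : ZMod ℓ) ≠ 0 := fun h ↦ (isUnit_576 (coprime_twelve_prime hℓ)).ne_zero
      (by linear_combination (24 : ZMod ℓ) * h)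
    rw [show (576 : ZMod ℓ) = 24 ^ 2 by norm_num, map_pow, legendreChar_sq h24]
  rw [← mul_unitInv (coprime_twelve_prime hℓ) u, map_mul, map_mul, h576]
  linear_combination (-legendreChar ℓ (unitInv (coprime_twelve_prime hℓ) u : (ZMod ℓ)ˣ)) *
    legendreChar_sq u.ne_zero

namespace HasEtaInversion

variable {f : ℂ → ℂ} {σ : ℂ}

lemma unitSum_prime_sq (h : HasEtaInversion r m f) (hℓ : 3 < ℓ) (hσ : 0 < σ.im) :
    unitSum f (ℓ ^ 2) 1 (-1 / σ) = autFactor r m σ * unitSum f (ℓ ^ 2) 1 σ := by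
  rw [h.unitSum_neg_one_div ((coprime_twelve_prime hℓ).pow_right 2) (ψ' := 1) (κ := 1)
    (fun u ↦ ?_) hσ, one_mul]
  simp only [gaussPhase_prime_sq hℓ, one_pow, Pi.one_apply]

lemma unitSum_prime_one (h : HasEtaInversion r m f) (hr : Odd r) (hℓ : 3 < ℓ) (hσ : 0 < σ.im) :
    unitSum f ℓ 1 (-1 / σ) = primePhase ℓ ^ r * legendreChar ℓ (-1) * autFactor r m σ *
      unitSum f ℓ (legendreChar ℓ) σ := by
  refine h.unitSum_neg_one_div (coprime_twelve_prime hℓ) (fun u ↦ ?_) hσ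
  rw [gaussPhase_prime hℓ, mul_pow, legendreChar_pow_odd hr u.ne_zero, legendreChar_unitInv hℓ,
    Pi.one_apply]
  linear_combination (-legendreChar ℓ u * primePhase ℓ ^ r) * legendreChar_neg_one_sq (ℓ := ℓ)

lemma unitSum_prime_legendreChar (h : HasEtaInversion r m f) (hr : Odd r) (hℓ : 3 < ℓ)
    (hσ : 0 < σ.im) :
    unitSum f ℓ (legendreChar ℓ) (-1 / σ) =
      primePhase ℓ ^ r * autFactor r m σ * unitSum f ℓ 1 σ := by
  refine h.unitSum_neg_one_div (coprime_twelve_prime hℓ) (fun u ↦ ?_) hσ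
  rw [gaussPhase_prime hℓ, mul_pow, legendreChar_pow_odd hr u.ne_zero, Pi.one_apply]
  linear_combination primePhase ℓ ^ r * legendreChar_sq u.ne_zero

end HasEtaInversion

section Rescaling

variable {A B : ℂ → ℂ} {κ : ℂ} {c : ℝ} {τ : ℂ}

lemma apply_neg_one_div_div
    (h : ∀ σ : ℂ, 0 < σ.im → A (-1 / σ) = κ * autFactor r m σ * B σ) (hc : 0 < c) (hτ : 0 < τ.im) :
    A (-1 / τ / c) = κ * √c ^ (r + 2 * m) * autFactor r m τ * B (c * τ) := by
  rw [div_div, mul_comm τ, h _ (by simpa using mul_pos hc hτ), autFactor_ofReal_mul hc]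
  ring

lemma sqrt_pow_mul_apply_mul_neg_one_div
    (h : ∀ σ : ℂ, 0 < σ.im → A (-1 / σ) = κ * autFactor r m σ * B σ) (hc : 0 < c) (hτ : 0 < τ.im) :
    √c ^ (r + 2 * m) * A (c * (-1 / τ)) = κ * autFactor r m τ * B (τ / c) := by
  have hc0 : (c : ℂ) ≠ 0 := Complex.ofReal_ne_zero.mpr hc.ne'
  have him : 0 < (τ / c).im := by rw [Complex.div_ofReal_im]; positivity
  have hfactor := autFactor_ofReal_mul (r := r) (m := m) hc (τ / c)
  rw [mul_div_cancel₀ _ hc0] at hfactor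
  rw [show (c : ℂ) * (-1 / τ) = -1 / (τ / c) by field_simp, h _ him, hfactor]
  ring

end Rescaling

/-- The Hecke operator `T(ℓ²)` on functions with an expansion in powers of `q^(1/24)`, normalised to
preserve the inversion formula of `η^r F`, as a sum over the matrices of determinant `ℓ²`. -/
def heckeSum (r m ℓ : ℕ) [Fact ℓ.Prime] (f : ℂ → ℂ) (z : ℂ) : ℂ :=
  ((ℓ : ℂ) ^ 2)⁻¹ * (f (z / ℓ ^ 2) + unitSum f ℓ 1 (z / ℓ) + unitSum f (ℓ ^ 2) 1 z +
    primePhase ℓ ^ r * legendreChar ℓ (-1) *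
      (√ℓ ^ (r + 2 * m) * unitSum f ℓ (legendreChar ℓ) (ℓ * z)) +
    ℓ ^ (r + 2 * m) * f (ℓ ^ 2 * z))

/- The inversion fixes the sum over the units modulo `ℓ²`, and exchanges the first term with the
last and the two sums over the units modulo `ℓ`. -/
theorem HasEtaInversion.heckeSum_neg_one_div {f : ℂ → ℂ} (h : HasEtaInversion r m f) (hr : Odd r)
    (hℓ : 3 < ℓ) {τ : ℂ} (hτ : 0 < τ.im) :
    heckeSum r m ℓ f (-1 / τ) = autFactor r m τ * heckeSum r m ℓ f τ := by
  have hpos : (0 : ℝ) < ℓ := Nat.cast_pos.mpr (NeZero.pos ℓ)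
  have hf (σ : ℂ) (hσ : 0 < σ.im) : f (-1 / σ) = 1 * autFactor r m σ * f σ := by
    rw [one_mul, h.apply_neg_one_div hσ]
  have hfirst := apply_neg_one_div_div hf (pow_pos hpos 2) hτ
  have hlast := sqrt_pow_mul_apply_mul_neg_one_div hf (pow_pos hpos 2) hτ
  rw [Real.sqrt_sq hpos.le] at hfirst hlast
  have hone := apply_neg_one_div_div (fun σ hσ ↦ h.unitSum_prime_one hr hℓ hσ) hpos hτ
  have hlegendre :=
    sqrt_pow_mul_apply_mul_neg_one_div (fun σ hσ ↦ h.unitSum_prime_legendreChar hr hℓ hσ) hpos hτ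
  push_cast at hfirst hlast hone hlegendre
  rw [heckeSum, heckeSum, hfirst, hone, h.unitSum_prime_sq hℓ hτ, hlegendre, hlast]
  linear_combination (((ℓ : ℂ) ^ 2)⁻¹ * legendreChar ℓ (-1) * autFactor r m τ *
    unitSum f ℓ 1 (τ / ℓ)) * primePhase_pow_mul_self hr hℓ +
    (((ℓ : ℂ) ^ 2)⁻¹ * autFactor r m τ * unitSum f ℓ 1 (τ / ℓ)) * legendreChar_neg_one_sq (ℓ := ℓ)

end HeckeInversion

section EtaForm

variable {r m : ℕ}

lemma eta_add_natCast (z : ℂ) (j : ℕ) : eta (z + j) = qParam 24 j * eta z := by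
  have hq : qParam 1 (z + j) = qParam 1 z := by
    have hj : qParam 1 (j : ℂ) = 1 := Complex.exp_eq_one_iff.mpr ⟨j, by push_cast; ring⟩
    rw [qParam_add, hj, mul_one]
  simp only [eta, eta_q, hq, qParam_add]
  ring

lemma etaForm_add_natCast (r : ℕ) (F : ModularForm 𝒮ℒ (m : ℤ)) (z : ℂ) (j : ℕ) :
    etaForm r F (z + j) = qParam 24 j ^ r * etaForm r F z := by
  have hF := (SlashInvariantFormClass.periodic_comp_ofComplex F one_mem_strictPeriods_SL).nat_mul
    j z
  simp only [Function.comp_apply, Complex.ofReal_one, mul_one] at hF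
  rw [etaForm, etaForm, hF, eta_add_natCast, mul_pow, mul_assoc]

lemma etaForm_coe (r : ℕ) (F : ℍ → ℂ) (τ : ℍ) : etaForm r F (24 * τ) = etaTwist r F τ := by
  rw [etaForm, etaTwist, ← ofComplex_apply (dilate 24 τ)]
  rfl

lemma qParam_period : qParam 24 (24 : ℕ) = 1 :=
  Complex.exp_eq_one_iff.mpr ⟨1, by push_cast; ring⟩

lemma periodic_etaTwist (r : ℕ) (F : ModularForm 𝒮ℒ (m : ℤ)) :
    Function.Periodic (etaTwist r F ∘ ofComplex) ((1 : ℝ) : ℂ) := by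
  intro w
  by_cases hw : 0 < w.im
  · have hw' : 0 < (w + (1 : ℝ)).im := by simpa using hw
    have h := etaForm_add_natCast r F (24 * w) 24
    rw [qParam_period, one_pow, one_mul] at h
    simp only [Function.comp_apply, ofComplex_apply_of_im_pos hw, ofComplex_apply_of_im_pos hw',
      ← etaForm_coe]
    rw [← h]
    push_cast
    ring_nf
  · have hw' : (w + (1 : ℝ)).im ≤ 0 := by simpa using hw
    simp only [Function.comp_apply, ofComplex_apply_of_im_nonpos (not_lt.mp hw),
      ofComplex_apply_of_im_nonpos hw']

lemma isBoundedAtImInfty_etaTwist (hr : Odd r) (F : ModularForm 𝒮ℒ (m : ℤ)) :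
    IsBoundedAtImInfty (etaTwist r F) := by
  have hpair : IsShimuraPair 1 (fun _ ↦ 1) :=
    ⟨mdifferentiable_const, 1, norm_one, fun τ ↦ by simp⟩
  have hslash : halfSlash (m + (r - 1) / 2) (etaTwist r F) 1 (fun _ ↦ 1) = etaTwist r F := by
    funext τ
    rw [halfSlash, one_pow, inv_one, one_mul, one_smul]
  exact hslash ▸ (isZeroAtImInfty_halfSlash_etaTwist hr F hpair).boundedAtFilter

lemma hasExpansion_etaForm (hr : Odd r) (F : ModularForm 𝒮ℒ (m : ℤ)) :
    HasExpansion (etaForm r F) fun n ↦ (qExpansion 1 (etaTwist r F)).coeff n := by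
  intro z hz
  have hz24 : 0 < (z / 24).im := by simpa [Complex.div_im] using hz
  have h := UpperHalfPlane.hasSum_qExpansion one_pos (periodic_etaTwist r F)
    (mdifferentiable_etaTwist r F.holo') (isBoundedAtImInfty_etaTwist hr F) ⟨z / 24, hz24⟩
  simp only [smul_eq_mul, qParam_one_eq, ← etaForm_coe] at h
  rwa [mul_div_cancel₀ z (by norm_num)] at h

lemma differentiableOn_etaForm (r : ℕ) (F : ModularForm 𝒮ℒ (m : ℤ)) :
    DifferentiableOn ℂ (etaForm r F) {z | 0 < z.im} :=
  DifferentiableOn.mul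
    (fun _ hz ↦ ((differentiableAt_eta_of_mem_upperHalfPlaneSet hz).pow r).differentiableWithinAt)
    (UpperHalfPlane.mdifferentiable_iff.mp F.holo')

end EtaForm

section Translation

variable {r : ℕ} {f g : ℂ → ℂ} {a b : ℕ → ℂ}

lemma isPrimitiveRoot_qParam_one : IsPrimitiveRoot (qParam 24 1) 24 := by
  simpa [qParam] using Complex.isPrimitiveRoot_exp 24 (by norm_num)

namespace HasExpansion

lemma const_mul (h : HasExpansion f a) (κ : ℂ) :
    HasExpansion (fun z ↦ κ * f z) fun n ↦ κ * a n := fun z hz ↦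
  ((h z hz).mul_left κ).congr_fun fun _ ↦ mul_assoc _ _ _

lemma comp_add_one (h : HasExpansion f a) :
    HasExpansion (fun z ↦ f (z + 1)) fun n ↦ qParam 24 1 ^ n * a n := fun z hz ↦
  (h (z + 1) (by simpa using hz)).congr_fun fun n ↦ by rw [qParam_add]; ring

/- The difference of the two expansions is an expansion of the zero modular form. -/
lemma eqOn_iff (hf : HasExpansion f a) (hg : HasExpansion g b) :
    (∀ z : ℂ, 0 < z.im → f z = g z) ↔ a = b := by
  refine ⟨fun hfg ↦ funext fun n ↦ sub_eq_zero.mp ?_, ?_⟩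
  · have hperiod : (24 : ℝ) ∈ (𝒮ℒ : Subgroup (GL (Fin 2) ℝ)).strictPeriods := by
      simpa using nsmul_mem one_mem_strictPeriods_SL 24
    have hzero (τ : ℍ) : HasSum (fun n ↦ (a n - b n) • qParam 24 τ ^ n)
        ((0 : ModularForm 𝒮ℒ 0) τ) := by
      have hsub := (hf τ τ.im_pos).sub (hg τ τ.im_pos)
      rw [hfg τ τ.im_pos, sub_self] at hsub
      exact hsub.congr_fun fun n ↦ sub_mul _ _ _
    rw [ModularFormClass.qExpansion_coeff_unique (by norm_num) hperiod hzero n,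
      FunLike.coe_zero, UpperHalfPlane.qExpansion_zero, map_zero]
  · rintro rfl z hz
    exact (hf z hz).unique (hg z hz)

lemma apply_add_one_iff (h : HasExpansion f a) :
    (∀ z : ℂ, 0 < z.im → f (z + 1) = qParam 24 1 ^ r * f z) ↔
      ∀ n, a n ≠ 0 → n ≡ r [MOD 24] := by
  rw [h.comp_add_one.eqOn_iff (h.const_mul _), funext_iff]
  refine forall_congr' fun n ↦ ?_
  rw [mul_eq_mul_right_iff,
    (isPrimitiveRoot_qParam_one.isOfFinOrder (by norm_num)).pow_eq_pow_iff_modEq,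
    ← isPrimitiveRoot_qParam_one.eq_orderOf, or_iff_not_imp_right]

/- The series is `q^(r/24)` times a power series in `q`. -/
lemma isBigO_qParam_pow (h : HasExpansion f a) (hr : r < 24)
    (ha : ∀ n, a n ≠ 0 → n ≡ r [MOD 24]) :
    (fun τ : ℍ ↦ f τ) =O[atImInfty] fun τ : ℍ ↦ qParam 24 (τ : ℂ) ^ r := by
  have hq (τ : ℍ) : qParam 24 (τ : ℂ) ^ r ≠ 0 := pow_ne_zero _ (Function.Periodic.qParam_ne_zero _)
  have hinj : Function.Injective fun j : ℕ ↦ 24 * j + r := fun i j hij ↦ by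
    simp only at hij
    omega
  have hpower (τ : ℍ) : HasSum (fun j : ℕ ↦ a (24 * j + r) • qParam 1 (τ : ℂ) ^ j)
      (f τ / qParam 24 (τ : ℂ) ^ r) := by
    have hdiv := (h τ τ.im_pos).div_const (qParam 24 (τ : ℂ) ^ r)
    rw [← hinj.hasSum_iff] at hdiv
    · refine hdiv.congr_fun fun j ↦ ?_
      rw [Function.comp_apply, eq_div_iff (hq τ), pow_add, pow_mul, ← qParam_natCast_mul 24 24,
        Nat.cast_ofNat, ← qParam_one_eq, smul_eq_mul, mul_assoc]
    · intro n hn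
      rw [show a n = 0 from not_not.mp fun hne ↦ hn ⟨n / 24, ?_⟩, zero_mul, zero_div]
      have := ha n hne
      rw [Nat.ModEq, Nat.mod_eq_of_lt hr] at this
      simp only
      omega
  have hbdd : IsBoundedAtImInfty fun τ : ℍ ↦ f τ / qParam 24 (τ : ℂ) ^ r :=
    isBoundedAtImInfty_of_hasSum_qExpansion one_pos hpower
  simpa only [Pi.one_apply, one_smul, smul_eq_mul, div_mul_cancel₀ _ (hq _)] using
    Asymptotics.IsBigO.smul hbdd
      (Asymptotics.isBigO_refl (fun τ : ℍ ↦ qParam 24 (τ : ℂ) ^ r) atImInfty)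

end HasExpansion

end Translation

section LevelOne

variable {k : ℤ} {r m : ℕ} {f : ℂ → ℂ}

/- `S` and `T` generate `SL₂(ℤ)`, and the only cusp is `∞`. -/
lemma exists_modularForm_of_slash {g : ℍ → ℂ} (hS : g ∣[k] ModularGroup.S = g)
    (hT : g ∣[k] ModularGroup.T = g) (hholo : MDifferentiable 𝓘(ℂ) 𝓘(ℂ) g)
    (hbdd : IsBoundedAtImInfty g) : ∃ G : ModularForm 𝒮ℒ k, ⇑G = g := by
  have hslash := SlashInvariantForm.slash_action_generators_SL2Z hS hT
  refine ⟨⟨⟨g, ?_⟩, hholo, fun {c} hc ↦ ?_⟩, rfl⟩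
  · rintro _ ⟨γ, rfl⟩
    exact hslash γ
  · rw [OnePoint.isBoundedAt_iff_forall_SL2Z hc]
    intro γ _
    change IsBoundedAtImInfty (g ∣[k] γ)
    rwa [hslash]

lemma denom_intCast (γ : SL(2, ℤ)) (τ : ℍ) : denom γ τ = (γ 1 0 : ℂ) * τ + γ 1 1 := by
  simp [denom]

lemma div_eta_pow_slash_T (hf : ∀ z : ℂ, 0 < z.im → f (z + 1) = qParam 24 1 ^ r * f z) :
    (fun τ : ℍ ↦ f τ / eta τ ^ r) ∣[k] ModularGroup.T = fun τ : ℍ ↦ f τ / eta τ ^ r := by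
  funext τ
  have hsmul : ((ModularGroup.T • τ : ℍ) : ℂ) = τ + 1 := by
    rw [UpperHalfPlane.modular_T_smul, coe_vadd, Complex.ofReal_one, add_comm]
  have hdenom : denom ModularGroup.T τ = 1 := by
    rw [denom_intCast]; simp [ModularGroup.T]
  have hη := eta_add_natCast τ 1
  rw [Nat.cast_one] at hη
  simp only [SL_slash_apply, hdenom, one_zpow, mul_one, hsmul, hf τ τ.im_pos, hη, mul_pow]
  exact mul_div_mul_left _ _ (pow_ne_zero r (Function.Periodic.qParam_ne_zero 1))

lemma div_eta_pow_slash_S (hf : ∀ z : ℂ, 0 < z.im → f (-1 / z) = autFactor r m z * f z) :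
    (fun τ : ℍ ↦ f τ / eta τ ^ r) ∣[(m : ℤ)] ModularGroup.S = fun τ : ℍ ↦ f τ / eta τ ^ r := by
  funext τ
  have hsmul : ((ModularGroup.S • τ : ℍ) : ℂ) = -1 / τ := by
    rw [UpperHalfPlane.modular_S_smul, coe_mk, inv_neg, neg_div, one_div]
  have hdenom : denom ModularGroup.S τ = τ := by
    rw [denom_intCast]; simp [ModularGroup.S]
  have hsqrt : ((-Complex.I * τ) ^ (1 / 2 : ℂ)) ^ r ≠ 0 :=
    pow_ne_zero _ fun h ↦ neg_I_mul_ne_zero τ.im_pos (Complex.cpow_eq_zero_iff _ _ |>.mp h).1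
  have hη : eta τ ^ r ≠ 0 := pow_ne_zero r (eta_ne_zero τ.im_pos)
  have hτ := τ.ne_zero
  simp only [SL_slash_apply, hdenom, hsmul, hf τ τ.im_pos, eta_neg_one_div τ.im_pos, autFactor,
    mul_pow, zpow_neg, zpow_natCast]
  field_simp [hsqrt, hη, hτ]

lemma isBigO_qParam_eta :
    (fun τ : ℍ ↦ qParam 24 (τ : ℂ)) =O[atImInfty] fun τ : ℍ ↦ eta τ := by
  refine Asymptotics.IsBigO.of_pow (n := 24) (by norm_num) ?_
  refine Asymptotics.IsBigO.trans ?_ exp_isBigO_discriminant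
  refine Asymptotics.IsBigO.of_norm_le fun τ ↦ ?_
  rw [Pi.pow_apply, ← qParam_natCast_mul 24 24, Nat.cast_ofNat, ← qParam_one_eq,
    Function.Periodic.norm_qParam, div_one, coe_im]

theorem exists_eq_etaForm {a : ℕ → ℂ} (h : HasExpansion f a)
    (hr : r < 24) (ha : ∀ n, a n ≠ 0 → n ≡ r [MOD 24])
    (hdiff : DifferentiableOn ℂ f {z | 0 < z.im})
    (hS : ∀ z : ℂ, 0 < z.im → f (-1 / z) = autFactor r m z * f z) :
    ∃ G : ModularForm 𝒮ℒ (m : ℤ), ∀ z : ℂ, 0 < z.im → f z = etaForm r G z := by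
  have hη (z : ℂ) (hz : 0 < z.im) : eta z ^ r ≠ 0 := pow_ne_zero r (eta_ne_zero hz)
  have hholo : MDifferentiable 𝓘(ℂ) 𝓘(ℂ) fun τ : ℍ ↦ f τ / eta τ ^ r := by
    rw [UpperHalfPlane.mdifferentiable_iff]
    refine (hdiff.div (fun z hz ↦ ((differentiableAt_eta_of_mem_upperHalfPlaneSet hz).pow
      r).differentiableWithinAt) hη).congr fun z hz ↦ ?_
    simp only [Function.comp_apply, ofComplex_apply_of_im_pos hz, Pi.div_apply, Pi.pow_apply]
  have hbdd : IsBoundedAtImInfty fun τ : ℍ ↦ f τ / eta τ ^ r := by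
    have hO := ((h.isBigO_qParam_pow hr ha).trans (isBigO_qParam_eta.pow r)).mul
      (Asymptotics.isBigO_refl (fun τ : ℍ ↦ (eta τ ^ r)⁻¹) atImInfty)
    simp only [mul_inv_cancel₀ (hη _ (im_pos _)), ← div_eq_mul_inv] at hO
    exact hO.trans (Asymptotics.isBigO_const_const _ one_ne_zero _)
  obtain ⟨G, hG⟩ := exists_modularForm_of_slash (div_eta_pow_slash_S hS)
    (div_eta_pow_slash_T (h.apply_add_one_iff.mpr ha)) hholo hbdd
  refine ⟨G, fun z hz ↦ ?_⟩
  rw [etaForm, hG, ofComplex_apply_of_im_pos hz]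
  exact (mul_div_cancel₀ _ (hη z hz)).symm

end LevelOne

section HeckeExpansion

variable {r m ℓ : ℕ} [Fact ℓ.Prime]

lemma chiTwelve576_prime (hℓ : 3 < ℓ) : chiTwelve576 ℓ = chiTwelve ℓ := by
  have h12 := (coprime_twelve_prime hℓ).symm
  have h576 : Nat.Coprime ℓ 576 :=
    (h12.pow_right 2).mul_right ((h12.coprime_dvd_right (by norm_num : 4 ∣ 12)))
  simpa using chiTwelve576_intCast (d := ℓ) (Nat.isCoprime_iff_coprime.mpr h576)

lemma primePhase_pow_mul_sqrt_pow (hr : Odd r) (hm : Even m) (hℓ : 3 < ℓ) :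
    primePhase ℓ ^ r * legendreChar ℓ (-1) * √ℓ ^ (r + 2 * m) * legendreGauss ℓ =
      chiTwelve ℓ * legendreChar ℓ (-1) ^ (m + (r - 1) / 2) * ℓ ^ (m + (r - 1) / 2 + 1) := by
  obtain ⟨t, rfl⟩ := hr
  obtain ⟨p, rfl⟩ := hm
  have hsqrt : ((√ℓ : ℝ) : ℂ) ^ 2 = ℓ := by
    rw [← Complex.ofReal_pow, Real.sq_sqrt (Nat.cast_nonneg _), Complex.ofReal_natCast]
  have hsqrt0 : ((√ℓ : ℝ) : ℂ) ≠ 0 := fun h ↦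
    NeZero.ne (ℓ : ℂ) (by rw [← hsqrt, h, zero_pow two_ne_zero])
  have hphase : primePhase ℓ * √ℓ * legendreGauss ℓ = chiTwelve ℓ * (legendreChar ℓ (-1) * ℓ) := by
    rw [← legendreGauss_sq (by omega), primePhase]
    field_simp
  have hone : legendreChar ℓ (-1) ^ (p + p) = 1 := by
    rw [← two_mul, pow_mul, legendreChar_neg_one_sq, one_pow]
  rw [show (2 * t + 1 - 1) / 2 = t by omega,
    show 2 * t + 1 + 2 * (p + p) = 2 * (t + (p + p)) + 1 by ring,
    pow_succ (primePhase ℓ), pow_mul (primePhase ℓ), primePhase_sq hℓ, pow_succ (Complex.ofReal _),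
    pow_mul (Complex.ofReal _), hsqrt, pow_add _ (p + p) t, hone]
  linear_combination (legendreChar ℓ (-1) ^ (t + 1) * (ℓ : ℂ) ^ (t + (p + p))) * hphase +
    chiTwelve ℓ * legendreChar ℓ (-1) ^ t * (ℓ : ℂ) ^ (t + (p + p) + 1) *
      legendreChar_neg_one_sq (ℓ := ℓ)

lemma heckeSum_coeff_legendre (hr : Odd r) (hm : Even m) (hℓ : 3 < ℓ) (n : ℕ) :
    ((ℓ : ℂ) ^ 2)⁻¹ * (primePhase ℓ ^ r * legendreChar ℓ (-1) * √ℓ ^ (r + 2 * m)) *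
        (legendreChar ℓ n * legendreGauss ℓ) =
      chiTwelve576 ℓ * legendreSym ℓ ((-1) ^ (m + (r - 1) / 2) * n) *
        (ℓ : ℂ) ^ (((m + (r - 1) / 2 : ℕ) : ℤ) - 1) := by
  have hℓ0 : (ℓ : ℂ) ≠ 0 := NeZero.ne _
  have hphase := primePhase_pow_mul_sqrt_pow hr hm hℓ
  set k := m + (r - 1) / 2
  have hpow : (ℓ : ℂ) ^ ((k : ℤ) - 1) = ((ℓ : ℂ) ^ 2)⁻¹ * ℓ ^ (k + 1) := by
    rw [zpow_sub_one₀ hℓ0, zpow_natCast]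
    field_simp
    ring
  rw [chiTwelve576_prime hℓ, ← legendreChar_intCast, hpow]
  push_cast
  rw [map_mul, map_pow]
  linear_combination (((ℓ : ℂ) ^ 2)⁻¹ * legendreChar ℓ n) * hphase

lemma heckeSum_coeff_dilate (hr : Odd r) (hℓ : 3 < ℓ) :
    ((ℓ : ℂ) ^ 2)⁻¹ * ℓ ^ (r + 2 * m) =
      chiTwelve576 ((ℓ ^ 2 : ℕ) : ZMod 576) *
        (ℓ : ℂ) ^ (2 * ((m + (r - 1) / 2 : ℕ) : ℤ) - 1) := by
  obtain ⟨t, rfl⟩ := hr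
  have hℓ0 : (ℓ : ℂ) ≠ 0 := NeZero.ne _
  rw [Nat.cast_pow, map_pow, chiTwelve576_prime hℓ,
    chiTwelve_sq_of_coprime (coprime_twelve_prime hℓ), one_mul, ← zpow_natCast, ← zpow_natCast,
    ← zpow_neg, ← zpow_add₀ hℓ0, show (2 * t + 1 - 1) / 2 = t by omega]
  congr 1
  push_cast
  ring

theorem hasExpansion_heckeSum {f : ℂ → ℂ} {a : ℕ → ℂ} (h : HasExpansion f a) (hr : Odd r)
    (hm : Even m) (hℓ : 3 < ℓ) :
    HasExpansion (heckeSum r m ℓ f) (heckeCoeff (m + (r - 1) / 2) chiTwelve576 ℓ a) := by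
  intro z hz
  have hmul := h.hasSum_coeff_mul (D := ℓ ^ 2) hz
  have htwist := (h.hasSum_coeff_mul_legendreChar (ℓ := ℓ) (by omega) hz).mul_left
    (((ℓ : ℂ) ^ 2)⁻¹ * (primePhase ℓ ^ r * legendreChar ℓ (-1) * √ℓ ^ (r + 2 * m)))
  have hdiv := (h.hasSum_coeff_div (D := ℓ ^ 2) hz).mul_left
    (((ℓ : ℂ) ^ 2)⁻¹ * ℓ ^ (r + 2 * m))
  rw [h.sum_translate_prime_sq hz] at hmul
  rw [sum_legendreChar_mul_translate] at htwist
  have hsum := (hmul.add htwist).add hdiv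
  push_cast at hsum
  convert hsum using 1
  · funext n
    rw [heckeCoeff, ← heckeSum_coeff_legendre hr hm hℓ, ← heckeSum_coeff_dilate hr hℓ]
    ring
  · rw [heckeSum]
    ring

lemma hasSum_heckeTerm (hr : Odd r) (hm : Even m) (hℓ : 3 < ℓ) (F : ModularForm 𝒮ℒ (m : ℤ))
    (τ : ℍ) :
    HasSum (heckeTerm (m + (r - 1) / 2) chiTwelve576 ℓ (etaTwist r F) τ)
      (heckeSum r m ℓ (etaForm r F) (24 * τ)) := by
  refine (hasExpansion_heckeSum (hasExpansion_etaForm hr F) hr hm hℓ (24 * τ)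
    (natCast_mul_im_pos (by norm_num) τ.im_pos)).congr_fun fun n ↦ ?_
  rw [heckeTerm, qParam_one_eq]

lemma prime_sq_modEq_one (hℓ : 3 < ℓ) : ℓ ^ 2 ≡ 1 [MOD 24] := by
  have h12 := (coprime_twelve_prime hℓ).symm
  have hunit : IsUnit (ℓ : ZMod 24) := (ZMod.isUnit_iff_coprime ℓ 24).mpr
    (h12.mul_right (h12.coprime_dvd_right (by norm_num : 2 ∣ 12)))
  have hsq : ∀ x : ZMod 24, IsUnit x → x ^ 2 = 1 := by decide
  rw [← ZMod.natCast_eq_natCast_iff, Nat.cast_pow, Nat.cast_one, hsq _ hunit]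

lemma modEq_of_heckeCoeff_ne_zero {k N : ℕ} {χ : DirichletCharacter ℂ N} (hℓ : 3 < ℓ)
    {a : ℕ → ℂ} (ha : ∀ n, a n ≠ 0 → n ≡ r [MOD 24]) {n : ℕ} (hn : heckeCoeff k χ ℓ a n ≠ 0) :
    n ≡ r [MOD 24] := by
  have hmul (j : ℕ) : ℓ ^ 2 * j ≡ j [MOD 24] := by
    simpa only [one_mul] using (prime_sq_modEq_one hℓ).mul_right j
  contrapose! hn
  have hself : a n = 0 := by_contra fun h ↦ hn (ha n h)
  have hmul_sq : a (ℓ ^ 2 * n) = 0 := by_contra fun h ↦ hn ((hmul n).symm.trans (ha _ h))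
  have hdiv_sq : (if ℓ ^ 2 ∣ n then a (n / ℓ ^ 2) else 0) = 0 := by
    rw [ite_eq_right_iff]
    rintro ⟨j, rfl⟩
    rw [Nat.mul_div_cancel_left _ (NeZero.pos _)]
    exact by_contra fun h ↦ hn ((hmul j).trans (ha j h))
  rw [heckeCoeff, hself, hmul_sq, hdiv_sq, mul_zero, mul_zero, add_zero, add_zero]

end HeckeExpansion

section HeckeForm

variable {r m ℓ : ℕ} [Fact ℓ.Prime]

lemma differentiableOn_unitSum {f : ℂ → ℂ} (hf : DifferentiableOn ℂ f {z | 0 < z.im}) (D : ℕ)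
    [NeZero D] (ψ : ZMod D → ℂ) : DifferentiableOn ℂ (unitSum f D ψ) {z | 0 < z.im} :=
  DifferentiableOn.fun_sum fun u _ ↦ DifferentiableOn.const_mul
    (hf.comp (by fun_prop) fun _ hz ↦
      mod_cast im_translate_pos (NeZero.ne D) hz ((u : ZMod D).val : ℤ)) _

lemma differentiableOn_heckeSum {f : ℂ → ℂ} (hf : DifferentiableOn ℂ f {z | 0 < z.im}) :
    DifferentiableOn ℂ (heckeSum r m ℓ f) {z | 0 < z.im} := by
  have hℓ : ℓ ≠ 0 := NeZero.ne ℓ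
  have hmul {D : ℕ} (hD : D ≠ 0) {g : ℂ → ℂ} (hg : DifferentiableOn ℂ g {z | 0 < z.im}) :
      DifferentiableOn ℂ (fun z ↦ g (D * z)) {z | 0 < z.im} :=
    hg.comp (by fun_prop) fun _ hz ↦ natCast_mul_im_pos hD hz
  have hdiv {D : ℕ} (hD : D ≠ 0) {g : ℂ → ℂ} (hg : DifferentiableOn ℂ g {z | 0 < z.im}) :
      DifferentiableOn ℂ (fun z ↦ g (z / D)) {z | 0 < z.im} :=
    hg.comp (by fun_prop) fun _ hz ↦ by simpa using im_translate_pos hD hz 0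
  have hmul_sq := hmul (pow_ne_zero 2 hℓ) hf
  have hdiv_sq := hdiv (pow_ne_zero 2 hℓ) hf
  push_cast at hmul_sq hdiv_sq
  have hunits := differentiableOn_unitSum hf (ℓ ^ 2) 1
  have hunits_div := hdiv hℓ (differentiableOn_unitSum hf ℓ 1)
  have hunits_mul := hmul hℓ (differentiableOn_unitSum hf ℓ (legendreChar ℓ))
  exact ((((hdiv_sq.add hunits_div).add hunits).add ((hunits_mul.const_mul _).const_mul _)).add
    (hmul_sq.const_mul _)).const_mul _

theorem exists_heckeT_eq_etaTwist (hr : Odd r) (hr24 : r < 24) (hm : Even m) (hℓ : 3 < ℓ)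
    (F : ModularForm 𝒮ℒ (m : ℤ)) :
    ∃ G : ModularForm 𝒮ℒ (m : ℤ),
      heckeT (m + (r - 1) / 2) chiTwelve576 ℓ (etaTwist r F) = etaTwist r G := by
  have hexp := hasExpansion_etaForm hr F
  have hsupp := hexp.apply_add_one_iff.mp fun z _ ↦ mod_cast etaForm_add_natCast r F z 1
  obtain ⟨G, hG⟩ := exists_eq_etaForm (hasExpansion_heckeSum hexp hr hm hℓ) hr24
    (fun _ ↦ modEq_of_heckeCoeff_ne_zero hℓ hsupp)
    (differentiableOn_heckeSum (differentiableOn_etaForm r F))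
    fun _ ↦ (hasEtaInversion_etaForm r F).heckeSum_neg_one_div hr hℓ
  refine ⟨G, funext fun τ ↦ ?_⟩
  have hτ : 0 < (24 * (τ : ℂ)).im := natCast_mul_im_pos (D := 24) (by norm_num) τ.im_pos
  rw [heckeT, (hasSum_heckeTerm hr hm hℓ F τ).tsum_eq, hG _ hτ, etaForm_coe]

theorem exists_heckeT_eq_smul (hr : Odd r) (hr24 : r < 24) (hm : Even m) (hℓ : 3 < ℓ)
    (hdim : Module.rank ℂ (ModularForm 𝒮ℒ (m : ℤ)) = 1) {F : ModularForm 𝒮ℒ (m : ℤ)}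
    (hF : F ≠ 0) :
    ∃ c : ℂ, heckeT (m + (r - 1) / 2) chiTwelve576 ℓ (etaTwist r F) = c • etaTwist r F := by
  obtain ⟨G, hG⟩ := exists_heckeT_eq_etaTwist hr hr24 hm hℓ F
  obtain ⟨c, rfl⟩ := (finrank_eq_one_iff_of_nonzero' F hF).mp
    (Module.rank_eq_one_iff_finrank_eq_one.mp hdim) G
  refine ⟨c, hG.trans (funext fun τ ↦ ?_)⟩
  exact mul_left_comm _ _ _

end HeckeForm

end HalfIntegral

end

theorem corollary3p2_general (r m : ℕ) (hr : Odd r) (hr24 : r < 24) (hm : Even m)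
    (hdim : Module.rank ℂ (ModularForm 𝒮ℒ (m : ℤ)) = 1)
    (F : ModularForm 𝒮ℒ (m : ℤ)) (hF : F ≠ 0) :
    HalfIntegral.IsCuspForm (m + (r - 1) / 2) 576 HalfIntegral.chiTwelve576
        (HalfIntegral.etaTwist r F) ∧
      HalfIntegral.etaTwist r F ≠ 0 ∧
      ∀ (ℓ : ℕ) [Fact ℓ.Prime], 3 < ℓ → ∃ c : ℂ,
        (∀ τ : ℍ, Summable (HalfIntegral.heckeTerm (m + (r - 1) / 2) HalfIntegral.chiTwelve576 ℓ
          (HalfIntegral.etaTwist r F) τ)) ∧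
        HalfIntegral.heckeT (m + (r - 1) / 2) HalfIntegral.chiTwelve576 ℓ
          (HalfIntegral.etaTwist r F) = c • HalfIntegral.etaTwist r F := by
  refine ⟨HalfIntegral.isCuspForm_etaTwist hr hm F,
    HalfIntegral.etaTwist_ne_zero r (DFunLike.coe_injective.ne hF), ?_⟩
  intro ℓ _ hℓ
  obtain ⟨c, hc⟩ := HalfIntegral.exists_heckeT_eq_smul hr hr24 hm hℓ hdim hF
  exact ⟨c, fun τ ↦ (HalfIntegral.hasSum_heckeTerm hr hm hℓ F τ).summable, hc⟩

theorem corollary3p2 (r m : ℕ) (hr1 : 1 ≤ r) (hr23 : r ≤ 23) (hr6 : Nat.Coprime r 6)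
    (hm : Even m) (hdim : Module.rank ℂ (ModularForm 𝒮ℒ (m : ℤ)) = 1)
    (F : ModularForm 𝒮ℒ (m : ℤ)) (hF : F ≠ 0) :
    HalfIntegral.IsCuspForm (m + (r - 1) / 2) 576 HalfIntegral.chiTwelve576
        (HalfIntegral.etaTwist r F) ∧
      HalfIntegral.etaTwist r F ≠ 0 ∧
      ∀ (ℓ : ℕ) [Fact ℓ.Prime], 3 < ℓ → ∃ c : ℂ,
        (∀ τ : ℍ, Summable (HalfIntegral.heckeTerm (m + (r - 1) / 2) HalfIntegral.chiTwelve576 ℓ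
          (HalfIntegral.etaTwist r F) τ)) ∧
        HalfIntegral.heckeT (m + (r - 1) / 2) HalfIntegral.chiTwelve576 ℓ
          (HalfIntegral.etaTwist r F) = c • HalfIntegral.etaTwist r F := by
  exact corollary3p2_general r m (Nat.coprime_two_right.mp (hr6.coprime_dvd_right (by norm_num)))
    (by omega) hm hdim F hF
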